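/- Let $\mathbb S^n=(\mathbb R^{n+1}\smallsetminus\{0\})/\mathbb R_{>0}$ be the projective sphere with the quotient topology, and for $U\subset\mathbb R^{n+1}$ let $\mathbb S(U)$ be the image of $U\smallsetminus\{0\}$. A subset of $\mathbb S^n$ is \emph{convex} if it is $\mathbb S(U)$ for a convex cone $U$, and \emph{properly convex} if moreover its closure contains no pair of antipodal points; a \emph{properly convex domain} is a nonempty open properly convex subset. Let $\mathrm{SL}^{\pm}_{n+1}\mathbb R$ be the group of matrices of determinant $\pm1$. A subgroup $\Gamma$ of it \emph{divides} a properly convex domain $\Omega$ if $\Gamma$ is discrete, preserves $\Omega$ and acts cocompactly on it, i.e. $\Omega=\Gamma K$ for some compact $K\subset\Omega$. A \emph{mirror polytope} in $\mathbb S^n$ with facets labelled by a finite set $S$ consists of linear forms $\alpha_s$ and vectors $b_s$ ($s\in S$) with $\alpha_s(b_s)=2$ such that $P=\bigcap_{s}\mathbb S(\{\alpha_s\le 0\})$ is properly convex with nonempty interior, no half-space $\mathbb S(\{\alpha_s\le0\})$ contains the intersection of the others, and for all $s\ne t$ the numbers $\alpha_s(b_t),\alpha_t(b_s)$ are both negative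 or both zero. Its reflections are $\sigma_s=\mathrm{Id}-\alpha_s\otimes b_s\in\mathrm{SL}^\pm_{n+1}\mathbb R$, its facets are $P\cap\mathbb S(\ker\alpha_s)$, and its Cartan matrix $(\alpha_s(b_t))_{s,t}$ is considered up to conjugation by positive diagonal matrices. A projective rotation of angle $\varphi\in(0,2\pi)$ is a linear map that is the identity on a subspace $H$ of codimension $2$ and induces on $\mathbb R^{n+1}/H$ a map conjugate to the rotation matrix of angle $\varphi$. The dihedral angle at a ridge (face of codimension $2$) $s\cap t$ is $\theta\in(0,\pi/2]$ if $\sigma_s\sigma_t$ is a projective rotation of angle $2\theta$, and $0$ if there is no such $\theta$. The mirror polytope is a \emph{Coxeter polytope} if each dihedral angle is $0$ or $\pi/m$ for an integer $m\ge2$. Let $t_3=\frac12\bigl(11+9\sqrt2-3\sqrt{31+22\sqrt2}\bigr)$ and, for $t\in[t_3,1]$ and $q=0,1,2,3$, let $$f(t)=\frac{t(t+2)^3(2t+1)^3}{(t^2+t+1)^2(t^2+7t+1)^2},\qquad h(t)=2+\frac1t+\frac{t(t+2)^4}{(t^2+t+1)(t^2+7t+1)},$$ $$g_q(t)=\frac{2t^q(t+2)^q(2t+1)^{3-q}}{(t^2+t+1)(t^2+7t+1)},\qquad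 \overline g_q(t)=\frac{4f(t)}{g_q(t)}.$$ Let $C_t=\begin{pmatrix}A_t&-h(t)I_5\\-2I_5&B_t\end{pmatrix}$, with rows and columns indexed by $1',\dots,5',1,\dots,5$, where $A_t$ and $B_t$ are the $5\times5$ matrices with diagonal entries $2$ and with $(A_t)_{ij}=-\overline g_{j-i-1}(t)$, $(B_t)_{ij}=-1/t$ for $i<j$, and $(A_t)_{ij}=-g_{i-j-1}(t)$, $(B_t)_{ij}=-t$ for $i>j$. For $\alpha\in[0,\pi/3]$, let $P_\alpha$ denote a mirror polytope in $\mathbb S^4$ with ten facets and Cartan matrix $C_t$, where $t\in[t_3,1]$ satisfies $f(t)=\cos^2\alpha$. Then for every integer $p\ge3$ a mirror polytope $P_{\pi/p}$ exists, and every such $P_{\pi/p}$ is a Coxeter polytope. Moreover, if $\Gamma_p\subset\mathrm{SL}^{\pm}_5\mathbb R$ is the subgroup generated by its reflections, then the orbit $\Omega_p=\bigcup_{\gamma\in\Gamma_p}\gamma P_{\pi/p}$ is a properly convex domain of $\mathbb S^4$ (in particular it is open, so it equals its interior), and $\Gamma_p$ divides $\Omega_p$. -/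

import Mathlib

open scoped Pointwise

noncomputable section

namespace ProjGeom

/-- The vector space `ℝⁿ⁺¹`. -/
abbrev Vec (n : ℕ) : Type := Fin (n + 1) → ℝ

/-- The projective sphere `𝕊ⁿ = (ℝⁿ⁺¹ ∖ {0}) / ℝ_{>0}`; the antipode of `x` is `-x`. -/
abbrev ProjSphere (n : ℕ) : Type := Module.Ray ℝ (Vec n)

/-- The canonical projection `ℝⁿ⁺¹ ∖ {0} → 𝕊ⁿ`. -/
def toSphere (n : ℕ) (v : {v : Vec n // v ≠ 0}) : ProjSphere n := rayOfNeZero ℝ v.1 v.2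

/-- The quotient topology on `𝕊ⁿ`. -/
instance instTopologicalSpaceProjSphere (n : ℕ) : TopologicalSpace (ProjSphere n) :=
  TopologicalSpace.coinduced (toSphere n) inferInstance

/-- `𝕊(U)`, the image of `U ∖ {0}` in the projective sphere. -/
def sph {n : ℕ} (U : Set (Vec n)) : Set (ProjSphere n) :=
  {x | ∃ (v : Vec n) (hv : v ≠ 0), v ∈ U ∧ rayOfNeZero ℝ v hv = x}

/-- A subset of `𝕊ⁿ` is convex if it is `𝕊(U)` for a convex cone `U`. -/
def IsConvex {n : ℕ} (P : Set (ProjSphere n)) : Prop :=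
  ∃ U : ConvexCone ℝ (Vec n), P = sph (U : Set (Vec n))

/-- Properly convex: convex, and the closure contains no pair of antipodal points. -/
def IsProperlyConvex {n : ℕ} (P : Set (ProjSphere n)) : Prop :=
  IsConvex P ∧ ∀ x ∈ closure P, -x ∉ closure P

/-- A properly convex domain: a nonempty open properly convex subset. -/
def IsProperlyConvexDomain {n : ℕ} (Ω : Set (ProjSphere n)) : Prop :=
  Ω.Nonempty ∧ IsOpen Ω ∧ IsProperlyConvex Ω

/-- The closed half-space `𝕊({α ≤ 0})`. -/
def halfSpace {n : ℕ} (α : Module.Dual ℝ (Vec n)) : Set (ProjSphere n) := sph {v | α v ≤ 0}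

/-- The set `P` is a projective polytope with `(α s)` as its minimal family of defining forms. -/
def IsProjectivePolytope {n : ℕ} {S : Type} (P : Set (ProjSphere n))
    (α : S → Module.Dual ℝ (Vec n)) : Prop :=
  IsProperlyConvex P ∧ (interior P).Nonempty ∧ P = ⋂ s, halfSpace (α s) ∧
    ∀ s, ¬ ((⋂ t ∈ {t : S | t ≠ s}, halfSpace (α t)) ⊆ halfSpace (α s))

/-- The group `SL^±_{n+1} ℝ` of linear automorphisms of `ℝⁿ⁺¹` of determinant `±1`. -/
def SLpm (n : ℕ) : Subgroup (Vec n ≃ₗ[ℝ] Vec n) where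
  carrier := {g | LinearEquiv.det g = 1 ∨ LinearEquiv.det g = -1}
  one_mem' := by simp
  mul_mem' := by
    rintro a b (ha | ha) (hb | hb) <;> simp [ha, hb]
  inv_mem' := by
    rintro a (ha | ha) <;> simp [ha]

/-- The topology of `SL^±_{n+1} ℝ` as a space of matrices. -/
instance instTopologicalSpaceSLpm (n : ℕ) : TopologicalSpace (SLpm n) :=
  TopologicalSpace.induced
    (fun g => LinearMap.toMatrix' ((g : Vec n ≃ₗ[ℝ] Vec n) : Vec n →ₗ[ℝ] Vec n)) inferInstance

/-- The group `Γ` divides `Ω`: `Ω` is a properly convex domain preserved by `Γ`, and `Γ` is a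
discrete subgroup of `SL^±_{n+1} ℝ` acting cocompactly on `Ω`. -/
def Divides {n : ℕ} (Γ : Subgroup (SLpm n)) (Ω : Set (ProjSphere n)) : Prop :=
  IsProperlyConvexDomain Ω ∧ (∀ γ ∈ Γ, γ • Ω = Ω) ∧ DiscreteTopology Γ ∧
    ∃ K : Set (ProjSphere n), IsCompact K ∧ K ⊆ Ω ∧ Ω = ⋃ γ ∈ Γ, γ • K

theorem reflection_mem_SLpm {n : ℕ} {α : Module.Dual ℝ (Vec n)} {b : Vec n} (h : α b = 2) :
    Module.reflection h ∈ SLpm n := by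
  have h1 : Module.reflection h * Module.reflection h = 1 := by
    ext1 v
    exact Module.involutive_reflection h v
  have h2 : LinearEquiv.det (Module.reflection h) * LinearEquiv.det (Module.reflection h) = 1 := by
    rw [← map_mul, h1, map_one]
  have h3 : ((LinearEquiv.det (Module.reflection h) : ℝˣ) : ℝ) *
      ((LinearEquiv.det (Module.reflection h) : ℝˣ) : ℝ) = 1 := by
    rw [← Units.val_mul, h2, Units.val_one]
  rcases mul_self_eq_one_iff.1 h3 with h4 | h4
  · exact Or.inl (Units.ext (by simpa using h4))
  · exact Or.inr (Units.ext (by simpa using h4))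

/-- The projective reflection `Id - α ⊗ b`, where `α(b) = 2`. -/
def projReflection {n : ℕ} (α : Module.Dual ℝ (Vec n)) (b : Vec n) (h : α b = 2) : SLpm n :=
  ⟨Module.reflection h, reflection_mem_SLpm h⟩

/-- `g` is a projective rotation of angle `θ`: it is the identity on a subspace `H` of
codimension 2, and on `ℝⁿ⁺¹ / H` it is given, in some basis, by the rotation matrix of angle `θ`,
where `0 < θ < 2π`. -/
def IsRotation {n : ℕ} (g : SLpm n) (θ : ℝ) : Prop :=
  0 < θ ∧ θ < 2 * Real.pi ∧
    ∃ (H : Submodule ℝ (Vec n))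
      (hH : H ≤ H.comap ((g : Vec n ≃ₗ[ℝ] Vec n) : Vec n →ₗ[ℝ] Vec n))
      (e : Module.Basis (Fin 2) ℝ (Vec n ⧸ H)),
      (∀ v ∈ H, (g : Vec n ≃ₗ[ℝ] Vec n) v = v) ∧
      LinearMap.toMatrix e e
          (H.mapQ H ((g : Vec n ≃ₗ[ℝ] Vec n) : Vec n →ₗ[ℝ] Vec n) hH) =
        !![Real.cos θ, -Real.sin θ; Real.sin θ, Real.cos θ]

/-- A mirror polytope in `𝕊ⁿ` with facets labelled by the finite set `S`, given by pairs
`(α s, b s)`: the polytope is `{α s ≤ 0 for all s}`, and the reflections are `Id - α s ⊗ b s`. -/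
structure MirrorPolytope (n : ℕ) (S : Type) [Finite S] where
  α : S → Module.Dual ℝ (Vec n)
  b : S → Vec n
  carrier : Set (ProjSphere n)
  isPolytope : IsProjectivePolytope carrier α
  apply_self : ∀ s, α s (b s) = 2
  sign : ∀ s t, s ≠ t → (α s (b t) < 0 ∧ α t (b s) < 0) ∨ (α s (b t) = 0 ∧ α t (b s) = 0)

namespace MirrorPolytope

variable {n : ℕ} {S : Type} [Finite S]

/-- The reflection along the facet `s`. -/
def refl (P : MirrorPolytope n S) (s : S) : SLpm n :=
  projReflection (P.α s) (P.b s) (P.apply_self s)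

/-- The facet with label `s`. -/
def facet (P : MirrorPolytope n S) (s : S) : Set (ProjSphere n) :=
  P.carrier ∩ sph {v | P.α s v = 0}

/-- The intersection of the facets `s` and `t` is a ridge, that is, a face of dimension `n - 2`:
the cone over it spans a linear subspace of dimension `n - 1`. -/
def IsRidge (P : MirrorPolytope n S) (s t : S) : Prop :=
  s ≠ t ∧ Module.finrank ℝ (Submodule.span ℝ
    {v : Vec n | ∃ hv : v ≠ 0, rayOfNeZero ℝ v hv ∈ P.facet s ∩ P.facet t}) + 2 = n + 1

/-- `θ` is the dihedral angle at `s ∩ t`: either `θ ∈ (0, π/2]` and the product of the two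
reflections is a rotation of angle `2θ`, or that product is no such rotation and `θ = 0`. -/
def IsDihedralAngle (P : MirrorPolytope n S) (s t : S) (θ : ℝ) : Prop :=
  (0 < θ ∧ θ ≤ Real.pi / 2 ∧ IsRotation (P.refl s * P.refl t) (2 * θ)) ∨
  (θ = 0 ∧ ¬ ∃ φ : ℝ, 0 < φ ∧ φ ≤ Real.pi / 2 ∧ IsRotation (P.refl s * P.refl t) (2 * φ))

/-- A Coxeter polytope: each dihedral angle is `π / m` for an integer `m ≥ 2` or `m = ∞`. -/
def IsCoxeter (P : MirrorPolytope n S) : Prop :=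
  ∀ s t, P.IsRidge s t → ∀ θ, P.IsDihedralAngle s t θ →
    θ = 0 ∨ ∃ m : ℕ, 2 ≤ m ∧ θ = Real.pi / m

/-- The subgroup of `SL^±_{n+1} ℝ` generated by the reflections of `P`. -/
def reflectionGroup (P : MirrorPolytope n S) : Subgroup (SLpm n) :=
  Subgroup.closure (Set.range P.refl)

/-- The union of the images of `P` under its reflection group. -/
def orbit (P : MirrorPolytope n S) : Set (ProjSphere n) :=
  ⋃ γ ∈ P.reflectionGroup, γ • P.carrier

/-- `A` is the Cartan matrix `(α s (b t))` of `P`. The pairs `(α s, b s)` are determined by the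
mirror polytope only up to `(d s • α s, (d s)⁻¹ • b s)` with `d s > 0`, so that the Cartan matrix
is defined up to conjugation by a positive diagonal matrix. -/
def HasCartanMatrix (P : MirrorPolytope n S) (A : Matrix S S ℝ) : Prop :=
  ∃ d : S → ℝ, (∀ s, 0 < d s) ∧ ∀ s t, P.α s (P.b t) = d s * A s t * (d t)⁻¹

end MirrorPolytope

def t₃ : ℝ := (1 / 2) * (11 + 9 * √2 - 3 * √(31 + 22 * √2))

def f (t : ℝ) : ℝ :=
  t * (t + 2) ^ 3 * (2 * t + 1) ^ 3 / ((t ^ 2 + t + 1) ^ 2 * (t ^ 2 + 7 * t + 1) ^ 2)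

def h (t : ℝ) : ℝ :=
  2 + 1 / t + t * (t + 2) ^ 4 / ((t ^ 2 + t + 1) * (t ^ 2 + 7 * t + 1))

/-- The function `g_p`, used for `p = 0, 1, 2, 3`. -/
def g (p : ℕ) (t : ℝ) : ℝ :=
  2 * t ^ p * (t + 2) ^ p * (2 * t + 1) ^ (3 - p) / ((t ^ 2 + t + 1) * (t ^ 2 + 7 * t + 1))

def gbar (p : ℕ) (t : ℝ) : ℝ := 4 * f t / g p t

/-- The `10 × 10` matrix `C_t`; the index `Sum.inl i` stands for the facet `F'_i` and the index
`Sum.inr i` for the facet `F_i`. -/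
def C (t : ℝ) : Matrix (Fin 5 ⊕ Fin 5) (Fin 5 ⊕ Fin 5) ℝ :=
  Matrix.fromBlocks
    !![2, -gbar 0 t, -gbar 1 t, -gbar 2 t, -gbar 3 t;
       -g 0 t, 2, -gbar 0 t, -gbar 1 t, -gbar 2 t;
       -g 1 t, -g 0 t, 2, -gbar 0 t, -gbar 1 t;
       -g 2 t, -g 1 t, -g 0 t, 2, -gbar 0 t;
       -g 3 t, -g 2 t, -g 1 t, -g 0 t, 2]
    (Matrix.diagonal fun _ => -h t)
    (Matrix.diagonal fun _ => -2)
    !![2, -(1 / t), -(1 / t), -(1 / t), -(1 / t);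
       -t, 2, -(1 / t), -(1 / t), -(1 / t);
       -t, -t, 2, -(1 / t), -(1 / t);
       -t, -t, -t, 2, -(1 / t);
       -t, -t, -t, -t, 2]

/-- `P` is the mirror polytope `P_a`, where `a ∈ [0, π/3]`: its Cartan matrix is `C_t` for the
parameter `t ∈ [t₃, 1]` that satisfies `cos² a = f t`. -/
def IsPolytopeOfAngle (a : ℝ) (P : MirrorPolytope 4 (Fin 5 ⊕ Fin 5)) : Prop :=
  a ∈ Set.Icc 0 (Real.pi / 3) ∧
    ∃ t ∈ Set.Icc t₃ 1, Real.cos a ^ 2 = f t ∧ P.HasCartanMatrix (C t)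

end ProjGeom

end

/-!
Products `α s (b t) * α t (b s)` of the form `4 cos² (π / m)` or at least `4` make the reflections
of a polytope satisfy the relations of a Coxeter group. By Tits' lemma, if `w` carries a point `v`
into the chamber and `w s` is longer than `w`, then `α s v ≤ 0`. Hence the translates of the
chamber form a convex cone, `w v - v` is a nonnegative combination of the `b s` for every `v` in
the chamber, and a nontrivial `w` carries no interior point of the chamber back into the chamber.

For `C_t` everything rests on the identity `A_t * B_t = 2 * h t`, which brings the rank of `C_t`
down to five. It says that the coordinates `a = -α (inl ·) x` and `c = -α (inr ·) x` of a point `x`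
satisfy `A_t c = -2 a`, `B_t a = -h t • c` and `x = ∑ (c i / 2) • b (inl i)`. So the chamber lies in
the hull of the `b s`, on all of which a Perron eigenvector of `B_t` provides a positive linear
form: the union of the translates is properly convex. For `x ≠ 0` in the chamber, since the
off-diagonal products `4 cos² (π / p)` of `A_t` and `1` of `B_t` are less than `4`, at most two
coordinates of `a` and two of `c` vanish, at different indices. The reflections fixing `x` therefore
generate a subgroup of a product of two finite dihedral groups, and this makes the union of the
translates open.
-/

namespace ProjGeom

open scoped Topology

section FiniteSubgroups

open Subgroup

variable {G : Type*} [Group G]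

theorem finite_sup_of_le_normalizer {H N : Subgroup G} [Finite H] [Finite N]
    (hHN : H ≤ normalizer N) : Finite ↥(H ⊔ N) := by
  have hfin : (↑(H ⊔ N) : Set G).Finite := by
    rw [coe_mul_of_left_le_normalizer_right H N hHN]
    exact (Set.toFinite _).mul (Set.toFinite _)
  exact hfin.to_subtype

theorem finite_closure_union_of_commute {A B : Set G} [Finite (closure A)] [Finite (closure B)]
    (hAB : ∀ a ∈ A, ∀ b ∈ B, Commute a b) : Finite (closure (A ∪ B)) := by
  rw [Subgroup.closure_union]
  refine finite_sup_of_le_normalizer ((closure_le _).2 fun a ha => ?_)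
  refine normalizer_le_normalizer_closure B (centralizer_le_normalizer B ?_)
  exact mem_centralizer_iff.2 fun b hb => (hAB a ha b hb).symm

theorem finite_closure_pair {x y : G} (hx : x * x = 1) (hy : y * y = 1)
    (hxy : IsOfFinOrder (x * y)) : Finite (closure {x, y}) := by
  have hle : closure {x, y} ≤ zpowers x ⊔ zpowers (x * y) := by
    have hxmem : x ∈ zpowers x ⊔ zpowers (x * y) := le_sup_left (a := zpowers x) (mem_zpowers x)
    have hxymem := le_sup_right (a := zpowers x) (mem_zpowers (x * y))
    rw [closure_le, Set.pair_subset_iff]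
    exact ⟨hxmem, by simpa using mul_mem (inv_mem hxmem) hxymem⟩
  have hnorm : zpowers x ≤ normalizer (zpowers (x * y) : Set G) := by
    have hconj : MulAut.conj x (x * y) = (x * y)⁻¹ := by
      rw [MulAut.conj_apply, ← mul_assoc, hx, one_mul, mul_inv_rev, ← eq_inv_of_mul_eq_one_left hy]
    rw [zpowers_le, mem_normalizer_iff_map_conj_eq, MonoidHom.map_zpowers, MonoidHom.coe_coe, hconj,
      zpowers_inv]
  have : Finite (zpowers x) :=
    finite_zpowers.2 (isOfFinOrder_iff_pow_eq_one.2 ⟨2, two_pos, by rwa [sq]⟩)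
  have : Finite (zpowers (x * y)) := finite_zpowers.2 hxy
  have := finite_sup_of_le_normalizer hnorm
  exact Set.Finite.subset (Set.toFinite (zpowers x ⊔ zpowers (x * y) : Subgroup G)) hle

end FiniteSubgroups

section CoxeterSystem

open CoxeterSystem

variable {S W : Type*} [Group W] {M : CoxeterMatrix S} (cs : CoxeterSystem M W)

theorem exists_eq_mul_wordProd_alternatingWord {w : W} {s t : S} (hs : ¬cs.IsRightDescent w s) :
    ∃ v k, w = v * cs.wordProd (alternatingWord s t k) ∧ cs.length w = cs.length v + k ∧
      ¬cs.IsRightDescent v s ∧ ¬cs.IsRightDescent v t := by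
  induction hw : cs.length w using Nat.strong_induction_on generalizing w s t with
  | _ l ih =>
  by_cases ht : cs.IsRightDescent w t
  · have hlt : cs.length (w * cs.simple t) + 1 = l := hw ▸ cs.isRightDescent_iff.1 ht
    obtain ⟨v, k, hv, hk, hvt, hvs⟩ :=
      ih _ (by omega) (t := s) (cs.isRightDescent_iff_not_isRightDescent_mul.1 ht) rfl
    refine ⟨v, k + 1, ?_, by omega, hvs, hvt⟩
    rw [alternatingWord_succ, wordProd_concat, ← mul_assoc, ← hv, simple_mul_simple_cancel_right]
  · exact ⟨w, 0, by simp [alternatingWord], hw.symm, hs, ht⟩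

theorem lt_of_eq_mul_wordProd_alternatingWord {v w : W} {s t : S} {k : ℕ}
    (hs : ¬cs.IsRightDescent w s) (hw : w = v * cs.wordProd (alternatingWord s t k))
    (hk : cs.length w = cs.length v + k) (hM : M s t ≠ 0) : k < M s t := by
  have hlen : cs.length w + 1 ≤
      cs.length v + cs.length (cs.wordProd (alternatingWord t s (k + 1))) := by
    rw [← cs.not_isRightDescent_iff.1 hs, hw, mul_assoc, ← wordProd_concat, ← alternatingWord_succ]
    exact cs.length_mul_le _ _
  by_contra! hle
  refine cs.not_isReduced_alternatingWord t s (m := k + 1) (M.symmetric t s ▸ hM)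
    (M.symmetric t s ▸ Nat.lt_succ_of_le hle) ?_
  have := cs.length_wordProd_le (alternatingWord t s (k + 1))
  rw [length_alternatingWord] at this
  rw [CoxeterSystem.IsReduced, length_alternatingWord]
  omega

theorem finite_closure_simple_image_of_subset_pair {s t : S} (hst : M s t ≠ 0) {F : Set S}
    (hF : F ⊆ {s, t}) : Finite (Subgroup.closure (cs.simple '' F)) := by
  have hpair : Finite (Subgroup.closure (cs.simple '' {s, t})) := by
    rw [Set.image_pair]
    exact finite_closure_pair (cs.simple_mul_simple_self s) (cs.simple_mul_simple_self t)
      (isOfFinOrder_iff_pow_eq_one.2 ⟨M s t, Nat.pos_of_ne_zero hst, cs.simple_mul_simple_pow s t⟩)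
  exact Finite.Set.subset _ (Subgroup.closure_mono (Set.image_mono hF))

theorem commute_simple_of_eq_two {s t : S} (hst : M s t = 2) :
    Commute (cs.simple s) (cs.simple t) := by
  have hpow := cs.simple_mul_simple_pow s t
  rw [hst, sq] at hpow
  have := eq_inv_of_mul_eq_one_left hpow
  rwa [mul_inv_rev, cs.inv_simple, cs.inv_simple] at this

theorem finite_closure_simple_image_union {F G : Set S}
    [Finite (Subgroup.closure (cs.simple '' F))] [Finite (Subgroup.closure (cs.simple '' G))]
    (hFG : ∀ s ∈ F, ∀ t ∈ G, M s t = 2) : Finite (Subgroup.closure (cs.simple '' (F ∪ G))) := by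
  rw [Set.image_union]
  refine finite_closure_union_of_commute ?_
  rintro _ ⟨s, hs, rfl⟩ _ ⟨t, ht, rfl⟩
  exact commute_simple_of_eq_two cs (hFG s hs t ht)

end CoxeterSystem

section Chebyshev

open Polynomial.Chebyshev

theorem eval_U_nonneg_of_one_le {c : ℝ} (hc : 1 ≤ c) (k : ℕ) : 0 ≤ (U ℝ k).eval c := by
  suffices 0 ≤ (U ℝ k).eval c ∧ (U ℝ k).eval c ≤ (U ℝ (k + 1)).eval c from this.1
  induction k with
  | zero =>
    have hU₁ : (U ℝ 1).eval c = 2 * c := by simp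
    rw [Nat.cast_zero, zero_add, U_zero, Polynomial.eval_one, hU₁]
    constructor <;> linarith
  | succ k ih =>
    have hrec : (U ℝ ((k : ℤ) + 1 + 1)).eval c =
        2 * c * (U ℝ (k + 1)).eval c - (U ℝ k).eval c := by
      rw [add_assoc, one_add_one_eq_two, U_add_two]; simp
    push_cast
    rw [hrec]
    constructor <;> nlinarith

theorem eval_U_cos_pi_div_nonneg {m k : ℕ} (hm : 2 ≤ m) (hk : k < m) :
    0 ≤ (U ℝ k).eval (Real.cos (Real.pi / m)) := by
  have hm' : (2 : ℝ) ≤ m := by exact_mod_cast hm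
  have hk' : (k : ℝ) + 1 ≤ m := by exact_mod_cast hk
  have hsin : 0 < Real.sin (Real.pi / m) :=
    Real.sin_pos_of_pos_of_lt_pi (by positivity) (div_lt_self Real.pi_pos (by linarith))
  refine nonneg_of_mul_nonneg_left ?_ hsin
  rw [U_real_cos]
  refine Real.sin_nonneg_of_nonneg_of_le_pi (by positivity) ?_
  rw [Int.cast_natCast, mul_div_assoc', div_le_iff₀ (by positivity), mul_comm]
  gcongr

theorem eq_eval_U_of_alternating_recurrence {c : ℝ} {x y : ℕ → ℝ}
    (hx₁ : x 1 = 2 * c * y 0 + x 0) (hy₁ : y 1 = 2 * c * x 0 + y 0)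
    (hx : ∀ k, x (k + 2) = 2 * c * y (k + 1) - x k)
    (hy : ∀ k, y (k + 2) = 2 * c * x (k + 1) - y k) (k : ℕ) :
    x k = (U ℝ k).eval c * (if Even k then x 0 else y 0) +
      (U ℝ (k - 1)).eval c * (if Even k then y 0 else x 0) := by
  induction k using Nat.strong_induction_on generalizing x y with
  | _ k ih =>
  match k with
  | 0 => simp
  | 1 => simp [hx₁]
  | k + 2 =>
    have hU : ∀ n : ℤ, (U ℝ (n + 2)).eval c = 2 * c * (U ℝ (n + 1)).eval c - (U ℝ n).eval c := by
      intro n; rw [U_add_two]; simp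
    have hcast : ((k + 2 : ℕ) : ℤ) - 1 = ((k : ℤ) - 1) + 2 := by push_cast; ring
    rw [hx, ih (k + 1) (by omega) hy₁ hx₁ hy hx, ih k (by omega) hx₁ hy₁ hx hy, hcast, hU]
    push_cast
    rw [hU]
    simp only [Nat.even_add_one, add_sub_cancel_right, sub_add_cancel]
    by_cases hk : Even k <;> simp [hk] <;> ring

end Chebyshev

section ReflectionPow

open Polynomial.Chebyshev Real

theorem eval_S_sub_one_eq_zero {θ : ℝ} {k : ℕ} (hθ : sin θ ≠ 0) (hk : k * θ = π) :
    (S ℝ ((k : ℤ) - 1)).eval (2 * cos θ) = 0 := by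
  refine (mul_eq_zero.1 ?_).resolve_right hθ
  rw [S_two_mul_real_cos]
  push_cast
  rw [sub_add_cancel, hk, sin_pi]

theorem eval_S_add_eval_S_sub_one_eq_zero {θ : ℝ} {k : ℕ} (hθ : sin θ ≠ 0)
    (hk : (2 * k + 1) * θ = 2 * π) :
    (S ℝ (k : ℤ)).eval (2 * cos θ) + (S ℝ ((k : ℤ) - 1)).eval (2 * cos θ) = 0 := by
  refine (mul_eq_zero.1 ?_).resolve_right hθ
  rw [add_mul, S_two_mul_real_cos, S_two_mul_real_cos]
  push_cast
  rw [sub_add_cancel, show (k + 1) * θ = 2 * π - k * θ by linarith, sin_two_pi_sub, neg_add_cancel]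

theorem reflection_mul_reflection_pow_eq_one {V : Type*} [AddCommGroup V] [Module ℝ V]
    {f g : Module.Dual ℝ V} {x y : V} (hf : f x = 2) (hg : g y = 2) {m : ℕ} (hm : 3 ≤ m)
    (hfg : f y * g x = 4 * cos (π / m) ^ 2) :
    (Module.reflection hf * Module.reflection hg) ^ m = 1 := by
  have hm' : (3 : ℝ) ≤ m := by exact_mod_cast hm
  obtain ⟨θ, hθ⟩ : ∃ θ, θ = 2 * (π / m) := ⟨_, rfl⟩
  have hmθ : m * θ = 2 * π := by rw [hθ]; field_simp
  have hsin : sin θ ≠ 0 := by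
    have : 0 < θ := by rw [hθ]; positivity
    exact (sin_pos_of_pos_of_lt_pi this (by nlinarith [pi_pos])).ne'
  have ht : 2 * cos θ = f y * g x - 2 := by rw [hfg, hθ, cos_two_mul]; ring
  ext1 z
  rw [Module.reflection_mul_reflection_pow_apply hf hg m z _ ht, LinearEquiv.coe_one, id_eq]
  obtain ⟨k, rfl | rfl⟩ := Nat.even_or_odd' m
  · have hS := eval_S_sub_one_eq_zero (k := k) hsin (by push_cast at hmθ; linarith)
    rw [show (((2 * k : ℕ) : ℤ) - 2) / 2 = k - 1 by omega,
      show (((2 * k : ℕ) : ℤ) - 1) / 2 = k - 1 by omega, hS]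
    simp
  · have hS := eval_S_add_eval_S_sub_one_eq_zero (k := k) hsin (by push_cast at hmθ; exact hmθ)
    rw [show (((2 * k + 1 : ℕ) : ℤ) - 2) / 2 = k - 1 by omega,
      show (((2 * k + 1 : ℕ) : ℤ) - 1) / 2 = k by omega,
      show (((2 * k + 1 : ℕ) : ℤ) - 3) / 2 = k - 1 by omega,
      show ((2 * k + 1 : ℕ) : ℤ) / 2 = k by omega, hS]
    simp

end ReflectionPow

/-- Vinberg's conditions on a family of reflections `Id - α s ⊗ b s` of a real vector space `V`:
the product of the reflections in `s` and `t` acts on a plane as a rotation of angle `2π / M s t`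
if `M s t ≠ 0`; the value `M s t = 0`, which encodes `∞`, stands for an infinite order. -/
structure IsVinbergFamily {S V : Type*} [AddCommGroup V] [Module ℝ V] (M : CoxeterMatrix S)
    (α : S → Module.Dual ℝ V) (b : S → V) : Prop where
  apply_self (s : S) : α s (b s) = 2
  sign {s t : S} : s ≠ t → (α s (b t) < 0 ∧ α t (b s) < 0) ∨ (α s (b t) = 0 ∧ α t (b s) = 0)
  angle {s t : S} : M s t ≠ 0 → α s (b t) * α t (b s) = 4 * Real.cos (Real.pi / M s t) ^ 2
  infinite_angle {s t : S} : M s t = 0 → 4 ≤ α s (b t) * α t (b s)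

namespace IsVinbergFamily

variable {S V W : Type*} [AddCommGroup V] [Module ℝ V] [Group W] {M : CoxeterMatrix S}
  {α : S → Module.Dual ℝ V} {b : S → V}

section

variable (h : IsVinbergFamily M α b) {s t : S}

include h

theorem apply_eq_zero_of_eq_two (hst : M s t = 2) : α s (b t) = 0 := by
  have hne : s ≠ t := by rintro rfl; simp at hst
  have hprod : α s (b t) * α t (b s) = 0 := by rw [h.angle (by omega), hst]; simp
  rcases h.sign hne with ⟨hs, ht⟩ | ⟨hs, -⟩
  · nlinarith
  · exact hs

theorem reflection_mul_self :
    Module.reflection (h.apply_self s) * Module.reflection (h.apply_self s) = 1 :=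
  LinearEquiv.ext (Module.involutive_reflection (h.apply_self s))

theorem isLiftable : M.IsLiftable fun s => Module.reflection (h.apply_self s) := by
  intro s t
  rcases eq_or_ne s t with rfl | hst
  · rw [M.diagonal, pow_one, h.reflection_mul_self]
  rcases Nat.lt_or_ge 2 (M s t) with hM | hM
  · exact reflection_mul_reflection_pow_eq_one _ _ hM (h.angle (by omega))
  have hM₁ := M.off_diagonal s t hst
  interval_cases hm : M s t
  · exact pow_zero _
  · contradiction
  · have hts := h.apply_eq_zero_of_eq_two (M.symmetric t s ▸ hm)
    ext1 z
    simp only [pow_two, LinearEquiv.mul_apply, LinearEquiv.coe_one, id_eq, Module.reflection_apply,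
      map_sub, map_smul, h.apply_eq_zero_of_eq_two hm, hts, h.apply_self]
    module

theorem exists_symmetrize {c : ℝ} (hc : 0 ≤ c) (hst : s ≠ t)
    (hprod : α s (b t) * α t (b s) = 4 * c ^ 2) :
    ∃ ρ > 0, α s (b t) = -(2 * c * ρ) ∧ ρ * α t (b s) = -(2 * c) := by
  rcases h.sign hst with ⟨hs, ht⟩ | ⟨hs, ht⟩
  · have hc : 0 < c := hc.lt_of_ne (by rintro rfl; nlinarith)
    refine ⟨-α s (b t) / (2 * c), div_pos (neg_pos.2 hs) (by positivity), by field, ?_⟩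
    rw [div_mul_eq_mul_div, neg_mul, hprod]
    field
  · have hc : c = 0 := by rw [hs, zero_mul] at hprod; nlinarith
    exact ⟨1, one_pos, by simp [hs, hc], by simp [ht, hc]⟩

open Polynomial.Chebyshev in
theorem exists_eval_U_nonneg (hst : s ≠ t) :
    ∃ c : ℝ, 0 ≤ c ∧ α s (b t) * α t (b s) = 4 * c ^ 2 ∧
      ∀ k : ℕ, (M s t ≠ 0 → k < M s t) → 0 ≤ (U ℝ k).eval c := by
  rcases Nat.eq_zero_or_pos (M s t) with hM | hM
  · have hprod := h.infinite_angle hM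
    refine ⟨√(α s (b t) * α t (b s) / 4), by positivity, ?_, fun k _ =>
      eval_U_nonneg_of_one_le (Real.one_le_sqrt.2 (by linarith)) k⟩
    rw [Real.sq_sqrt (by positivity)]
    ring
  · have hM₂ : 2 ≤ M s t := by have := M.off_diagonal s t hst; omega
    have hM₂' : (2 : ℝ) ≤ M s t := by exact_mod_cast hM₂
    refine ⟨Real.cos (Real.pi / M s t), Real.cos_nonneg_of_mem_Icc ⟨?_, ?_⟩,
      h.angle hM.ne', fun k hk => eval_U_cos_pi_div_nonneg hM₂ (hk hM.ne')⟩
    · linarith [Real.pi_pos, show 0 ≤ Real.pi / M s t by positivity]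
    · gcongr

end

/-- The action on `V` of the Coxeter group of `M`, the simple reflection `s` acting as
`Id - α s ⊗ b s`. -/
noncomputable def rep (h : IsVinbergFamily M α b) (cs : CoxeterSystem M W) : W →* (V ≃ₗ[ℝ] V) :=
  cs.lift ⟨fun s => Module.reflection (h.apply_self s), h.isLiftable⟩

variable (h : IsVinbergFamily M α b) (cs : CoxeterSystem M W)

@[simp]
theorem rep_simple (s : S) : h.rep cs (cs.simple s) = Module.reflection (h.apply_self s) :=
  cs.lift_apply_simple h.isLiftable s

theorem rep_simple_apply (s : S) (v : V) : h.rep cs (cs.simple s) v = v - α s v • b s := by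
  rw [rep_simple, Module.reflection_apply]

theorem rep_mul_apply (w w' : W) (v : V) : h.rep cs (w * w') v = h.rep cs w (h.rep cs w' v) := by
  rw [map_mul, LinearEquiv.mul_apply]

theorem apply_rep_simple_self (s : S) (v : V) : α s (h.rep cs (cs.simple s) v) = -α s v := by
  rw [rep_simple_apply, map_sub, map_smul, h.apply_self, smul_eq_mul]
  ring

open CoxeterSystem in
theorem rep_alternatingWord_succ_inv_apply (s t : S) (k : ℕ) (v : V) :
    h.rep cs (cs.wordProd (alternatingWord s t (k + 1)))⁻¹ v =
      h.rep cs (cs.simple t) (h.rep cs (cs.wordProd (alternatingWord t s k))⁻¹ v) := by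
  rw [alternatingWord_succ, wordProd_concat, mul_inv_rev, inv_simple, rep_mul_apply]

open CoxeterSystem in
/-- The values of `-α s` and `-α t` at the vectors below, symmetrized, satisfy the recurrence of
the Chebyshev polynomials of the second kind. -/
theorem apply_rep_alternatingWord_inv_nonpos {s t : S} (hst : s ≠ t) {v : V} (hs : α s v ≤ 0)
    (ht : α t v ≤ 0) {k : ℕ} (hk : M s t ≠ 0 → k < M s t) :
    α s (h.rep cs (cs.wordProd (alternatingWord s t k))⁻¹ v) ≤ 0 := by
  obtain ⟨c, hc, hprod, hU⟩ := h.exists_eval_U_nonneg hst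
  obtain ⟨ρ, hρ, hαs, hαt⟩ := h.exists_symmetrize hc hst hprod
  obtain ⟨y, hy⟩ : ∃ y : S → S → ℕ → V,
      ∀ s t k, y s t k = h.rep cs (cs.wordProd (alternatingWord s t k))⁻¹ v := ⟨_, fun _ _ _ => rfl⟩
  have hzero : ∀ s t, y s t 0 = v := fun s t => by
    rw [hy, alternatingWord, wordProd_nil, inv_one, map_one, LinearEquiv.coe_one, id_eq]
  have hstep : ∀ s t k, α s (y s t (k + 1)) = α s (y t s k) - α t (y t s k) * α s (b t) :=
    fun s t k => by
      rw [hy, rep_alternatingWord_succ_inv_apply, rep_simple_apply, map_sub, map_smul,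
        smul_eq_mul, hy]
  have hflip : ∀ s t k, α s (y t s (k + 1)) = -α s (y s t k) := fun s t k => by
    rw [hy, rep_alternatingWord_succ_inv_apply, apply_rep_simple_self, hy]
  have hsol := eq_eval_U_of_alternating_recurrence (c := c) (x := fun k => -α s (y s t k))
    (y := fun k => -(ρ * α t (y t s k)))
    (by simp only [hstep, hzero, hαs]; ring)
    (by simp only [hstep, hzero]; linear_combination (α s v) * hαt)
    (fun k => by simp only [hstep s t (k + 1), hflip, hαs]; ring)
    (fun k => by
      simp only [hstep t s (k + 1), hflip]; linear_combination (α s (y s t (k + 1))) * hαt) k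
  have hU' : 0 ≤ (Polynomial.Chebyshev.U ℝ ((k : ℤ) - 1)).eval c := by
    rcases k with - | k
    · simp
    · simpa using hU k fun hM => (Nat.lt_succ_self k).trans (hk hM)
  have hx : 0 ≤ -α s v := neg_nonneg.2 hs
  have hy' : 0 ≤ -(ρ * α t v) := neg_nonneg.2 (mul_nonpos_of_nonneg_of_nonpos hρ.le ht)
  rw [← hy, ← neg_nonneg, hsol]
  simp only [hzero]
  have := hU k hk
  split_ifs <;> positivity

open CoxeterSystem in
/-- Tits' lemma. -/
theorem apply_nonpos_of_not_isRightDescent {w : W} {v : V}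
    (hw : ∀ s, α s (h.rep cs w v) ≤ 0) {s : S} (hs : ¬cs.IsRightDescent w s) : α s v ≤ 0 := by
  induction hl : cs.length w using Nat.strong_induction_on generalizing w v s with
  | _ l ih =>
  rcases eq_or_ne w 1 with rfl | hw₁
  · simpa using hw s
  obtain ⟨t, ht⟩ := cs.exists_rightDescent_of_ne_one hw₁
  obtain ⟨u, k, hu, hlen, hus, hut⟩ := exists_eq_mul_wordProd_alternatingWord cs (t := t) hs
  set π := cs.wordProd (alternatingWord s t k) with hπ
  have hk : 0 < k := Nat.pos_of_ne_zero fun hk => hut <| by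
    rwa [hu, hπ, hk, alternatingWord, wordProd_nil, mul_one] at ht
  have hu' : ∀ r, α r (h.rep cs u (h.rep cs π v)) ≤ 0 := fun r => by
    rw [← rep_mul_apply, ← hu]; exact hw r
  have hinv : h.rep cs π⁻¹ (h.rep cs π v) = v := by simp
  rw [← hinv]
  exact h.apply_rep_alternatingWord_inv_nonpos cs (by rintro rfl; exact hs ht)
    (ih _ (by omega) hu' hus rfl) (ih _ (by omega) hu' hut rfl)
    (lt_of_eq_mul_wordProd_alternatingWord cs hs hu hlen)

end IsVinbergFamily

section Chamber

variable {S V : Type*} [AddCommGroup V] [Module ℝ V]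

/-- The closed cone cut out by the half-spaces `α s ≤ 0`: the cone over a projective polytope. -/
def chamber (α : S → Module.Dual ℝ V) : ConvexCone ℝ V where
  carrier := {v | ∀ s, α s v ≤ 0}
  smul_mem' c hc v hv s := by
    rw [map_smul]
    exact mul_nonpos_of_nonneg_of_nonpos hc.le (hv s)
  add_mem' v hv w hw s := by
    rw [map_add]
    exact add_nonpos (hv s) (hw s)

variable {α : S → Module.Dual ℝ V}

theorem mem_chamber {v : V} : v ∈ chamber α ↔ ∀ s, α s v ≤ 0 := Iff.rfl

theorem exists_add_smul_mem_chamber [Finite S] {x y : V} (hx : x ∈ chamber α)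
    (hxy : x + y ∉ chamber α) :
    ∃ s, 0 < α s y ∧ ∃ τ : ℝ, τ < 1 ∧ α s (x + τ • y) = 0 ∧ x + τ • y ∈ chamber α := by
  obtain ⟨r, hr⟩ : ∃ r, 0 < α r y := by
    by_contra! hy
    exact hxy ((chamber α).add_mem hx hy)
  -- `s` is the first wall that the segment from `x` to `x + y` crosses.
  obtain ⟨s, hs, hmin⟩ := Set.exists_min_image {s | 0 < α s y} (fun s => -α s x / α s y)
    (Set.toFinite _) ⟨r, hr⟩
  have hs : 0 < α s y := hs
  have hmin : ∀ r, 0 < α r y → -α s x / α s y * α r y ≤ -α r x := fun r hr =>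
    (le_div_iff₀ hr).1 (hmin r hr)
  have hτ : 0 ≤ -α s x / α s y := div_nonneg (neg_nonneg.2 (hx s)) hs.le
  refine ⟨s, hs, -α s x / α s y, ?_, ?_, fun r => ?_⟩
  · by_contra! hτ₁
    refine hxy fun r => ?_
    rw [map_add]
    rcases le_or_gt (α r y) 0 with hr | hr
    · linarith [hx r]
    · nlinarith [hmin r hr]
  · rw [map_add, map_smul, smul_eq_mul, div_mul_cancel₀ _ hs.ne', add_neg_cancel]
  · rw [map_add, map_smul, smul_eq_mul]
    rcases le_or_gt (α r y) 0 with hr | hr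
    · linarith [hx r, mul_nonpos_of_nonneg_of_nonpos hτ hr]
    · linarith [hmin r hr]

theorem isClosed_chamber [TopologicalSpace V] [IsTopologicalAddGroup V] [ContinuousSMul ℝ V]
    [T2Space V] [FiniteDimensional ℝ V] : IsClosed (chamber α : Set V) := by
  have hα (s : S) : IsClosed {v | α s v ≤ 0} :=
    isClosed_le (LinearMap.continuous_of_finiteDimensional _) continuous_const
  convert isClosed_iInter hα
  ext
  simp [mem_chamber]

theorem isOpen_setOf_forall_apply_neg [Finite S] [TopologicalSpace V] [IsTopologicalAddGroup V]
    [ContinuousSMul ℝ V] [T2Space V] [FiniteDimensional ℝ V] :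
    IsOpen {v : V | ∀ s, α s v < 0} := by
  simp only [Set.ofPred_forall]
  exact isOpen_iInter_of_finite fun s =>
    isOpen_lt (LinearMap.continuous_of_finiteDimensional _) continuous_const

end Chamber

namespace IsVinbergFamily

variable {S V W : Type*} [AddCommGroup V] [Module ℝ V] [Group W] {M : CoxeterMatrix S}
  {α : S → Module.Dual ℝ V} {b : S → V} (h : IsVinbergFamily M α b) (cs : CoxeterSystem M W)

theorem exists_rep_add_mem_chamber [Finite S] {x y : V} {w : W} (hx : x ∈ chamber α)
    (hy : h.rep cs w y ∈ chamber α) : ∃ w', h.rep cs w' (x + y) ∈ chamber α := by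
  induction hl : cs.length w using Nat.strong_induction_on generalizing w x y with
  | _ l ih =>
  by_cases hxy : x + y ∈ chamber α
  · exact ⟨1, by simpa using hxy⟩
  obtain ⟨s, hs, τ, hτ₁, hτs, hz⟩ := exists_add_smul_mem_chamber hx hxy
  have hdesc : cs.IsRightDescent w s := by
    by_contra hws
    exact hs.not_ge (h.apply_nonpos_of_not_isRightDescent cs hy hws)
  have hwall : h.rep cs (cs.simple s) (x + y) =
      (x + τ • y) + (1 - τ) • h.rep cs (cs.simple s) y := by
    simp only [rep_simple_apply, map_add, map_smul, smul_eq_mul] at hτs ⊢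
    rw [eq_neg_of_add_eq_zero_left hτs]
    module
  have hrefl : h.rep cs (w * cs.simple s) ((1 - τ) • h.rep cs (cs.simple s) y) ∈ chamber α := by
    rw [map_smul, ← rep_mul_apply, CoxeterSystem.simple_mul_simple_cancel_right]
    exact (chamber α).smul_mem (sub_pos.2 hτ₁) hy
  obtain ⟨w', hw'⟩ := ih _ (hl ▸ hdesc) hz hrefl rfl
  exact ⟨w' * cs.simple s, by rwa [rep_mul_apply, hwall]⟩

/-- The Tits cone: the union of the images of the chamber. -/
def titsCone [Finite S] : ConvexCone ℝ V where
  carrier := {v | ∃ w, h.rep cs w v ∈ chamber α}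
  smul_mem' := by
    rintro c hc v ⟨w, hw⟩
    exact ⟨w, by rw [map_smul]; exact (chamber α).smul_mem hc hw⟩
  add_mem' := by
    rintro x ⟨u, hu⟩ y ⟨w, hw⟩
    obtain ⟨w', hw'⟩ := h.exists_rep_add_mem_chamber cs (y := h.rep cs u y) (w := w * u⁻¹) hu
      (by rwa [← rep_mul_apply, inv_mul_cancel_right])
    exact ⟨w' * u, by rwa [rep_mul_apply, map_add]⟩

theorem mem_titsCone [Finite S] {v : V} :
    v ∈ h.titsCone cs ↔ ∃ w, h.rep cs w v ∈ chamber α := Iff.rfl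

theorem rep_mem_titsCone_iff [Finite S] (w : W) {v : V} :
    h.rep cs w v ∈ h.titsCone cs ↔ v ∈ h.titsCone cs := by
  simp only [mem_titsCone, ← rep_mul_apply]
  exact ((Group.mulRight_bijective w).surjective.exists
    (p := fun u => h.rep cs u v ∈ chamber α)).symm

theorem rep_sub_mem_hull {v : V} (hv : v ∈ chamber α) (w : W) :
    h.rep cs w v - v ∈ PointedCone.hull ℝ (Set.range b) := by
  induction hl : cs.length w generalizing w with
  | zero => simp [cs.length_eq_zero_iff.1 hl]
  | succ l ih =>
    obtain ⟨s, hs⟩ := cs.exists_leftDescent_of_ne_one (w := w) (by rintro rfl; simp at hl)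
    obtain ⟨u, hu⟩ : ∃ u, u = cs.simple s * w := ⟨_, rfl⟩
    have hw : w = cs.simple s * u := by rw [hu, CoxeterSystem.simple_mul_simple_cancel_left]
    have hus : ¬cs.IsRightDescent u⁻¹ s := by
      rwa [cs.isRightDescent_inv_iff, hu, ← cs.isLeftDescent_iff_not_isLeftDescent_mul]
    have hlu : cs.length u = l := by
      have := cs.isLeftDescent_iff.1 hs
      rw [← hu] at this
      omega
    have hα : α s (h.rep cs u v) ≤ 0 := h.apply_nonpos_of_not_isRightDescent cs
      (w := u⁻¹) (by rwa [← rep_mul_apply, inv_mul_cancel, map_one]) hus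
    rw [hw, rep_mul_apply, rep_simple_apply, sub_right_comm, sub_eq_add_neg, ← neg_smul]
    exact add_mem (ih u hlu) (PointedCone.smul_mem _ (neg_nonneg.2 hα)
      (PointedCone.subset_hull (Set.mem_range_self s)))

theorem titsCone_le_hull [Finite S]
    (hhull : ∀ v ∈ chamber α, v ∈ PointedCone.hull ℝ (Set.range b)) {v : V}
    (hv : v ∈ h.titsCone cs) : v ∈ PointedCone.hull ℝ (Set.range b) := by
  obtain ⟨w, hw⟩ := hv
  have := add_mem (h.rep_sub_mem_hull cs hw w⁻¹) (hhull _ hw)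
  rwa [sub_add_cancel, ← rep_mul_apply, inv_mul_cancel, map_one] at this

theorem eq_one_of_rep_mem_chamber {v : V} (hv : ∀ s, α s v < 0) {w : W}
    (hw : h.rep cs w v ∈ chamber α) : w = 1 := by
  by_contra hw₁
  obtain ⟨s, hs⟩ := cs.exists_rightDescent_of_ne_one hw₁
  have hα := h.apply_nonpos_of_not_isRightDescent cs (v := h.rep cs (cs.simple s) v)
    (w := w * cs.simple s) (by rwa [← rep_mul_apply, CoxeterSystem.simple_mul_simple_cancel_right])
    (cs.isRightDescent_iff_not_isRightDescent_mul.1 hs)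
  rw [apply_rep_simple_self] at hα
  linarith [hv s]

theorem rep_apply_eq_self_of_mem_closure {F : Set S} {x : V} (hx : ∀ s ∈ F, α s x = 0) {w : W}
    (hw : w ∈ Subgroup.closure (cs.simple '' F)) : h.rep cs w x = x := by
  induction hw using Subgroup.closure_induction with
  | mem _ hw =>
    obtain ⟨s, hs, rfl⟩ := hw
    rw [rep_simple_apply, hx s hs, zero_smul, sub_zero]
  | one => rw [map_one, LinearEquiv.coe_one, id_eq]
  | mul u w _ _ hu hw => rw [rep_mul_apply, hw, hu]
  | inv w _ hw =>
    nth_rw 1 [← hw]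
    rw [← rep_mul_apply, inv_mul_cancel, map_one, LinearEquiv.coe_one, id_eq]

theorem exists_mem_closure_forall_apply_nonpos {φ : Module.Dual ℝ V} (hφ : ∀ s, 0 < φ (b s))
    {F : Set S} [Finite (Subgroup.closure (cs.simple '' F))] (v : V) :
    ∃ w ∈ Subgroup.closure (cs.simple '' F), ∀ s ∈ F, α s (h.rep cs w v) ≤ 0 := by
  obtain ⟨w, hw, hmin⟩ := Set.exists_min_image
    (Subgroup.closure (cs.simple '' F) : Set W) (fun w => φ (h.rep cs w v)) (Set.toFinite _)
    ⟨1, one_mem _⟩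
  refine ⟨w, hw, fun s hs => ?_⟩
  have hle := hmin (cs.simple s * w) (mul_mem (Subgroup.subset_closure ⟨s, hs, rfl⟩) hw)
  rw [rep_mul_apply, rep_simple_apply, map_sub, map_smul, smul_eq_mul] at hle
  exact nonpos_of_mul_nonpos_left (by linarith) (hφ s)

section Topology

variable [TopologicalSpace V] [IsTopologicalAddGroup V] [ContinuousSMul ℝ V] [T2Space V]
  [FiniteDimensional ℝ V]

theorem continuous_rep (w : W) : Continuous (h.rep cs w) :=
  LinearMap.continuous_of_finiteDimensional (h.rep cs w : V →ₗ[ℝ] V)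

theorem titsCone_mem_nhds [Finite S] {φ : Module.Dual ℝ V} (hφ : ∀ s, 0 < φ (b s)) {x : V}
    (hx : x ∈ chamber α) (hfin : Finite (Subgroup.closure (cs.simple '' {s | α s x = 0}))) :
    (h.titsCone cs : Set V) ∈ 𝓝 x := by
  have hnear : ∀ᶠ y in 𝓝 x, ∀ w ∈ (Subgroup.closure (cs.simple '' {s | α s x = 0}) : Set W),
      ∀ s, α s x ≠ 0 → α s (h.rep cs w y) < 0 := by
    simp only [Filter.eventually_all_finite (Set.toFinite _), Filter.eventually_all]
    intro w hw s hs
    have hcont : Continuous fun y => α s (h.rep cs w y) :=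
      (LinearMap.continuous_of_finiteDimensional (α s)).comp (h.continuous_rep cs w)
    refine hcont.continuousAt.eventually_lt continuousAt_const ?_
    rw [h.rep_apply_eq_self_of_mem_closure cs (fun _ h => h) hw]
    exact (hx s).lt_of_ne hs
  filter_upwards [hnear] with y hy
  obtain ⟨w, hw, hwy⟩ :=
    h.exists_mem_closure_forall_apply_nonpos cs hφ (F := {s | α s x = 0}) y
  exact ⟨w, fun s => if hs : α s x = 0 then hwy s hs else (hy w hw s hs).le⟩

theorem isOpen_titsCone_diff_zero [Finite S] {φ : Module.Dual ℝ V} (hφ : ∀ s, 0 < φ (b s))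
    (hfin : ∀ x ∈ chamber α, x ≠ 0 →
      Finite (Subgroup.closure (cs.simple '' {s | α s x = 0}))) :
    IsOpen ((h.titsCone cs : Set V) \ {0}) := by
  refine isOpen_iff_mem_nhds.2 fun v hv => ?_
  obtain ⟨⟨w, hw⟩, hv₀⟩ := hv
  have hnhds := h.titsCone_mem_nhds cs hφ hw (hfin _ hw ((h.rep cs w).map_ne_zero_iff.2 hv₀))
  have hpre : h.rep cs w ⁻¹' (h.titsCone cs) = h.titsCone cs :=
    Set.ext fun _ => h.rep_mem_titsCone_iff cs w
  exact Filter.inter_mem (hpre ▸ (h.continuous_rep cs w).continuousAt hnhds)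
    (isOpen_compl_singleton.mem_nhds hv₀)

end Topology

end IsVinbergFamily

theorem exists_norm_le_of_mem_hull {ι E : Type*} [Finite ι] [NormedAddCommGroup E]
    [NormedSpace ℝ E] {b : ι → E} {φ : Module.Dual ℝ E} (hφ : ∀ i, 0 < φ (b i)) :
    ∃ K, ∀ v ∈ PointedCone.hull ℝ (Set.range b), ‖v‖ ≤ K * φ v := by
  obtain ⟨K, hK⟩ := (Set.finite_range fun i => ‖b i‖ / φ (b i)).bddAbove
  refine ⟨K, fun v hv => ?_⟩
  induction hv using Submodule.span_induction with
  | mem v hv =>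
    obtain ⟨i, rfl⟩ := hv
    exact (div_le_iff₀ (hφ i)).1 (hK ⟨i, rfl⟩)
  | zero => simp
  | add v w _ _ hv hw =>
    rw [map_add, mul_add]
    exact (norm_add_le v w).trans (add_le_add hv hw)
  | smul c v _ hv =>
    obtain ⟨c, hc⟩ := c
    change ‖c • v‖ ≤ K * φ (c • v)
    rw [norm_smul, Real.norm_of_nonneg hc, map_smul, smul_eq_mul, mul_left_comm]
    gcongr

section Sphere

variable {n : ℕ} {U : ConvexCone ℝ (Vec n)} {v : Vec n}

theorem rayOfNeZero_mem_sph (hv : v ≠ 0) : rayOfNeZero ℝ v hv ∈ sph (U : Set (Vec n)) ↔ v ∈ U := by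
  refine ⟨?_, fun h => ⟨v, hv, h, rfl⟩⟩
  rintro ⟨w, hw, hwU, h⟩
  obtain ⟨c, hc, rfl⟩ := ((ray_eq_iff hw hv).1 h).exists_pos_left hw hv
  exact U.smul_mem hc hwU

theorem toSphere_preimage_sph : toSphere n ⁻¹' sph (U : Set (Vec n)) = {v | v.1 ∈ U} :=
  Set.ext fun v => rayOfNeZero_mem_sph v.2

theorem continuous_toSphere : Continuous (toSphere n) := continuous_coinduced_rng

theorem rayOfNeZero_mem_halfSpace {α : Module.Dual ℝ (Vec n)} (hv : v ≠ 0) :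
    rayOfNeZero ℝ v hv ∈ halfSpace α ↔ α v ≤ 0 := by
  have hU : {v | α v ≤ 0} = (chamber fun _ : Unit => α : Set (Vec n)) := by
    ext
    simp [mem_chamber]
  rw [halfSpace, hU, rayOfNeZero_mem_sph, mem_chamber, forall_const]

theorem iInter_halfSpace {S : Type*} (α : S → Module.Dual ℝ (Vec n)) :
    ⋂ s, halfSpace (α s) = sph (chamber α : Set (Vec n)) := by
  ext x
  induction x using Module.Ray.ind with
  | h v hv =>
    simp only [Set.mem_iInter, rayOfNeZero_mem_halfSpace, rayOfNeZero_mem_sph, mem_chamber]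

theorem isOpen_sph (hU : IsOpen ((U : Set (Vec n)) \ {0})) : IsOpen (sph (U : Set (Vec n))) := by
  rw [isOpen_coinduced, toSphere_preimage_sph]
  convert hU.preimage continuous_subtype_val using 1
  ext v
  simp [v.2]

theorem isClosed_sph (hU : IsClosed (U : Set (Vec n))) : IsClosed (sph (U : Set (Vec n))) := by
  rw [isClosed_coinduced, toSphere_preimage_sph]
  exact hU.preimage continuous_subtype_val

theorem isCompact_sph (hU : IsClosed (U : Set (Vec n))) : IsCompact (sph (U : Set (Vec n))) := by
  have hne (v : ↑((U : Set (Vec n)) ∩ Metric.sphere 0 1)) : v.1 ≠ 0 :=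
    ne_zero_of_mem_unit_sphere ⟨v.1, v.2.2⟩
  have hcompact : CompactSpace ↑((U : Set (Vec n)) ∩ Metric.sphere 0 1) :=
    isCompact_iff_compactSpace.1 ((isCompact_sphere 0 1).inter_left hU)
  have hcont := continuous_toSphere.comp (continuous_subtype_val.subtype_mk hne)
  convert isCompact_range hcont using 1
  ext x
  constructor
  · rintro ⟨v, hv, hvU, rfl⟩
    have hpos : 0 < ‖v‖⁻¹ := inv_pos.2 (norm_pos_iff.2 hv)
    exact ⟨⟨‖v‖⁻¹ • v, U.smul_mem hpos hvU, by simp [norm_smul, hv]⟩,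
      ray_pos_smul hv hpos (smul_ne_zero hpos.ne' hv)⟩
  · rintro ⟨v, rfl⟩
    exact ⟨v, hne v, v.2.1, rfl⟩

theorem neg_notMem_closure_sph {φ : Module.Dual ℝ (Vec n)} (hU : ∀ v ∈ U, ‖v‖ ≤ φ v)
    {x : ProjSphere n} (hx : x ∈ closure (sph (U : Set (Vec n)))) :
    -x ∉ closure (sph (U : Set (Vec n))) := by
  let E : ConvexCone ℝ (Vec n) :=
    { carrier := {v | ‖v‖ ≤ φ v}
      smul_mem' c hc v (hv : ‖v‖ ≤ φ v) := by
        rw [Set.mem_ofPred_eq, norm_smul, map_smul, smul_eq_mul, Real.norm_of_nonneg hc.le]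
        gcongr
      add_mem' v (hv : ‖v‖ ≤ φ v) w (hw : ‖w‖ ≤ φ w) := by
        rw [Set.mem_ofPred_eq, map_add]
        exact (norm_add_le v w).trans (add_le_add hv hw) }
  have hclosed : IsClosed (E : Set (Vec n)) :=
    isClosed_le continuous_norm (LinearMap.continuous_of_finiteDimensional φ)
  have hsub : closure (sph (U : Set (Vec n))) ⊆ sph (E : Set (Vec n)) :=
    closure_minimal (fun _ ⟨v, hv, hvU, hvx⟩ => ⟨v, hv, hU v hvU, hvx⟩) (isClosed_sph hclosed)
  intro hx'
  obtain ⟨v, hv, hvE, rfl⟩ := hsub hx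
  have hnegE : -v ∈ E := (rayOfNeZero_mem_sph (neg_ne_zero.2 hv)).1 (hsub hx')
  have hle : ‖v‖ ≤ φ v := hvE
  have hle' : ‖-v‖ ≤ φ (-v) := hnegE
  rw [norm_neg, map_neg] at hle'
  linarith [norm_pos_iff.2 hv]

theorem continuous_SLpm_smul (v : Vec n) : Continuous fun γ : SLpm n => γ • v := by
  have hmul (γ : SLpm n) : γ • v =
      (LinearMap.toMatrix' ((γ : Vec n ≃ₗ[ℝ] Vec n) : Vec n →ₗ[ℝ] Vec n)).mulVec v := by
    rw [LinearMap.toMatrix'_mulVec]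
    rfl
  simp_rw [hmul]
  exact Continuous.matrix_mulVec continuous_induced_dom continuous_const

end Sphere

section Polytope

variable {n : ℕ} {S : Type} {α : S → Module.Dual ℝ (Vec n)}

theorem not_biInter_halfSpace_subset {s : S} {v : Vec n} (hs : 0 < α s v)
    (hle : ∀ r, r ≠ s → α r v ≤ 0) :
    ¬ (⋂ r ∈ {r | r ≠ s}, halfSpace (α r)) ⊆ halfSpace (α s) := by
  have hv : v ≠ 0 := by
    rintro rfl
    simp at hs
  have hmem : rayOfNeZero ℝ v hv ∈ ⋂ r ∈ {r | r ≠ s}, halfSpace (α r) :=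
    Set.mem_iInter₂.2 fun r hr => (rayOfNeZero_mem_halfSpace hv).2 (hle r hr)
  exact fun hsub => hs.not_ge ((rayOfNeZero_mem_halfSpace hv).1 (hsub hmem))

theorem nonempty_interior_iInter_halfSpace [Finite S] {v : Vec n} (hv₀ : v ≠ 0)
    (hv : ∀ s, α s v < 0) : (interior (⋂ s, halfSpace (α s))).Nonempty := by
  let U : ConvexCone ℝ (Vec n) :=
    { carrier := {w | ∀ s, α s w < 0}
      smul_mem' c hc w hw s := by
        rw [map_smul]
        exact mul_neg_of_pos_of_neg hc (hw s)
      add_mem' w hw w' hw' s := by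
        rw [map_add]
        exact add_neg (hw s) (hw' s) }
  have hopen : IsOpen (sph (U : Set (Vec n))) :=
    isOpen_sph (isOpen_setOf_forall_apply_neg.sdiff isClosed_singleton)
  have hsub : sph (U : Set (Vec n)) ⊆ ⋂ s, halfSpace (α s) := by
    rintro _ ⟨w, hw₀, hw, rfl⟩
    exact Set.mem_iInter.2 fun s => (rayOfNeZero_mem_halfSpace hw₀).2 (hw s).le
  exact ⟨_, interior_maximal hsub hopen ⟨v, hv₀, hv, rfl⟩⟩

theorem isProjectivePolytope_iInter_halfSpace [Finite S] [Nonempty S] {b : S → Vec n}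
    (hself : ∀ s, 0 < α s (b s)) (hle : ∀ s r, s ≠ r → α s (b r) ≤ 0) {φ : Module.Dual ℝ (Vec n)}
    (hφ : ∀ s, 0 < φ (b s)) (hhull : ∀ v ∈ chamber α, v ∈ PointedCone.hull ℝ (Set.range b))
    {v : Vec n} (hv : ∀ s, α s v < 0) :
    IsProjectivePolytope (⋂ s, halfSpace (α s)) α := by
  obtain ⟨K, hK⟩ := exists_norm_le_of_mem_hull hφ
  have hv₀ : v ≠ 0 := by
    rintro rfl
    simpa using hv (Classical.arbitrary S)
  refine ⟨⟨⟨_, iInter_halfSpace α⟩, ?_⟩, nonempty_interior_iInter_halfSpace hv₀ hv, rfl,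
    fun s => not_biInter_halfSpace_subset (hself s) fun r hr => hle r s hr⟩
  rw [iInter_halfSpace]
  exact fun x => neg_notMem_closure_sph (φ := K • φ) fun w hw => hK w (hhull w hw)

end Polytope

namespace MirrorPolytope

variable {n : ℕ} {S : Type} [Finite S] (P : MirrorPolytope n S)

theorem carrier_eq_sph_chamber : P.carrier = sph (chamber P.α : Set (Vec n)) := by
  rw [P.isPolytope.2.2.1, iInter_halfSpace]

theorem isCompact_carrier : IsCompact P.carrier := by
  rw [carrier_eq_sph_chamber]
  exact isCompact_sph isClosed_chamber

theorem carrier_subset_orbit : P.carrier ⊆ P.orbit := fun x hx =>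
  Set.mem_iUnion₂.2 ⟨1, one_mem _, by rwa [one_smul]⟩

theorem smul_orbit {γ : SLpm n} (hγ : γ ∈ P.reflectionGroup) : γ • P.orbit = P.orbit := by
  have hsub : ∀ γ ∈ P.reflectionGroup, γ • P.orbit ⊆ P.orbit := by
    intro γ hγ
    simp only [orbit, Set.smul_set_iUnion₂, smul_smul, Set.iUnion₂_subset_iff]
    exact fun γ' hγ' => Set.subset_iUnion₂_of_subset (γ * γ') (mul_mem hγ hγ') subset_rfl
  exact (hsub γ hγ).antisymm (Set.subset_smul_set_iff.2 (hsub _ (inv_mem hγ)))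

theorem exists_forall_apply_neg : ∃ v : Vec n, ∀ s, P.α s v < 0 := by
  obtain ⟨x, hx⟩ := P.isPolytope.2.1
  induction x using Module.Ray.ind with
  | h v hv =>
  refine ⟨v, fun s => ?_⟩
  have hnhds : ∀ᶠ w in nhds v, P.α s w ≤ 0 := by
    have hpre := continuous_toSphere.continuousAt.preimage_mem_nhds
      (x := ⟨v, hv⟩) (mem_interior_iff_mem_nhds.1 hx)
    rw [carrier_eq_sph_chamber, toSphere_preimage_sph] at hpre
    filter_upwards [(isOpen_ne.isOpenEmbedding_subtypeVal.image_mem_nhds).2 hpre]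
    rintro _ ⟨w, hw, rfl⟩
    exact hw s
  have hcont : Filter.Tendsto (fun ε : ℝ => v + ε • P.b s) (nhdsWithin 0 (Set.Ioi 0)) (nhds v) :=
    tendsto_nhdsWithin_of_tendsto_nhds (Continuous.tendsto' (by fun_prop) _ _ (by simp))
  obtain ⟨ε, hle, hε⟩ := ((hcont.eventually hnhds).and self_mem_nhdsWithin).exists
  have hε : 0 < ε := hε
  rw [map_add, map_smul, smul_eq_mul, P.apply_self] at hle
  linarith

section Vinberg

variable {P} {W : Type*} [Group W] {M : CoxeterMatrix S} (h : IsVinbergFamily M P.α P.b)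
  (cs : CoxeterSystem M W)

include h cs

theorem map_reflectionGroup :
    P.reflectionGroup.map (SLpm n).subtype = (h.rep cs).range := by
  rw [reflectionGroup, MonoidHom.map_closure, MonoidHom.range_eq_map,
    ← cs.subgroup_closure_range_simple, MonoidHom.map_closure, ← Set.range_comp, ← Set.range_comp]
  congr 2
  ext1 s
  exact (h.rep_simple cs s).symm

theorem mem_reflectionGroup_iff {γ : SLpm n} :
    γ ∈ P.reflectionGroup ↔ ∃ w, h.rep cs w = (γ : Vec n ≃ₗ[ℝ] Vec n) := by
  rw [← Subgroup.mem_map_iff_mem (SLpm n).subtype_injective, map_reflectionGroup h cs]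
  exact MonoidHom.mem_range

theorem exists_mem_reflectionGroup_eq_rep (w : W) :
    ∃ γ ∈ P.reflectionGroup, (γ : Vec n ≃ₗ[ℝ] Vec n) = h.rep cs w :=
  Subgroup.mem_map.1 ((map_reflectionGroup h cs).symm ▸ MonoidHom.mem_range.2 ⟨w, rfl⟩)

theorem orbit_eq_sph_titsCone : P.orbit = sph (h.titsCone cs : Set (Vec n)) := by
  ext x
  induction x using Module.Ray.ind with
  | h v hv =>
  have hsmul (γ : SLpm n) : rayOfNeZero ℝ v hv ∈ γ • P.carrier ↔ γ⁻¹ • v ∈ chamber P.α := by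
    rw [Set.mem_smul_set_iff_inv_smul_mem, carrier_eq_sph_chamber]
    exact rayOfNeZero_mem_sph _
  simp only [orbit, Set.mem_iUnion₂, hsmul, exists_prop, rayOfNeZero_mem_sph,
    IsVinbergFamily.mem_titsCone]
  constructor
  · rintro ⟨γ, hγ, hγv⟩
    obtain ⟨w, hw⟩ := (mem_reflectionGroup_iff h cs).1 (inv_mem hγ)
    exact ⟨w, hw ▸ hγv⟩
  · rintro ⟨w, hw⟩
    obtain ⟨γ, hγ, hγw⟩ := exists_mem_reflectionGroup_eq_rep h cs w
    exact ⟨γ⁻¹, inv_mem hγ, by rwa [inv_inv, Subgroup.smul_def, hγw]⟩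

theorem discreteTopology_reflectionGroup : DiscreteTopology P.reflectionGroup := by
  obtain ⟨v, hv⟩ := P.exists_forall_apply_neg
  refine discreteTopology_iff_isOpen_singleton.2 fun γ => ?_
  have hcont : Continuous fun δ : P.reflectionGroup => (γ : SLpm n)⁻¹ • (δ : SLpm n) • v :=
    (LinearMap.continuous_of_finiteDimensional
      (((γ : SLpm n)⁻¹ : SLpm n) : Vec n →ₗ[ℝ] Vec n)).comp
      ((continuous_SLpm_smul v).comp continuous_subtype_val)
  convert (isOpen_setOf_forall_apply_neg (α := P.α)).preimage hcont
  ext δ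
  refine ⟨by rintro rfl; simpa using hv, fun hδ => ?_⟩
  obtain ⟨w, hw⟩ := (mem_reflectionGroup_iff h cs).1 (mul_mem (inv_mem γ.2) δ.2)
  have hw₁ : w = 1 := h.eq_one_of_rep_mem_chamber cs hv fun s => by
    rw [hw]
    exact (hδ s).le
  rw [hw₁, map_one] at hw
  exact (Subtype.ext (inv_mul_eq_one.1 (Subtype.ext hw.symm))).symm

/-- A case of Vinberg's theorem. -/
theorem divides_orbit {φ : Module.Dual ℝ (Vec n)} (hφ : ∀ s, 0 < φ (P.b s))
    (hhull : ∀ v ∈ chamber P.α, v ∈ PointedCone.hull ℝ (Set.range P.b))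
    (hfin : ∀ x ∈ chamber P.α, x ≠ 0 →
      Finite (Subgroup.closure (cs.simple '' {s | P.α s x = 0}))) :
    Divides P.reflectionGroup P.orbit := by
  obtain ⟨K, hK⟩ := exists_norm_le_of_mem_hull hφ
  have horbit := orbit_eq_sph_titsCone h cs
  have hnonempty : P.orbit.Nonempty :=
    (P.isPolytope.2.1.mono interior_subset).mono P.carrier_subset_orbit
  have hopen : IsOpen P.orbit := by
    rw [horbit]
    exact isOpen_sph (h.isOpen_titsCone_diff_zero cs hφ hfin)
  have hproper : ∀ x ∈ closure P.orbit, -x ∉ closure P.orbit := by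
    rw [horbit]
    exact fun x => neg_notMem_closure_sph (φ := K • φ) fun v hv =>
      hK v (h.titsCone_le_hull cs hhull hv)
  exact ⟨⟨hnonempty, hopen, ⟨_, horbit⟩, hproper⟩, fun γ => P.smul_orbit,
    discreteTopology_reflectionGroup h cs, P.carrier, P.isCompact_carrier,
    P.carrier_subset_orbit, rfl⟩

end Vinberg

end MirrorPolytope

theorem trace_eq_finrank_add_trace_toMatrix_mapQ {K V ι : Type*} [Field K] [AddCommGroup V]
    [Module K V] [FiniteDimensional K V] [Fintype ι] [DecidableEq ι] {g : V →ₗ[K] V}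
    {H : Submodule K V} (hH : H ≤ H.comap g) (e : Module.Basis ι K (V ⧸ H))
    (hid : ∀ v ∈ H, g v = v) :
    LinearMap.trace K V g =
      Module.finrank K H + (LinearMap.toMatrix e e (H.mapQ H g hH)).trace := by
  let bH := Module.finBasis K H
  rw [LinearMap.trace_eq_matrix_trace K (Module.Basis.sumQuot bH e), Matrix.trace,
    Fintype.sum_sum_type]
  congr 1
  · simp [LinearMap.toMatrix_apply, Matrix.diag, hid]
  · refine Finset.sum_congr rfl fun j _ => ?_
    rw [Matrix.diag, Matrix.diag, LinearMap.toMatrix_apply, LinearMap.toMatrix_apply,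
      Module.Basis.sumQuot_repr_inr, ← Module.Basis.sumQuot_inr bH e j, H.mapQ_apply]
    rfl

theorem IsRotation.trace_eq {n : ℕ} {γ : SLpm n} {θ : ℝ} (hγ : IsRotation γ θ) :
    LinearMap.trace ℝ (Vec n) ((γ : Vec n ≃ₗ[ℝ] Vec n) : Vec n →ₗ[ℝ] Vec n) =
      n - 1 + 2 * Real.cos θ := by
  obtain ⟨-, -, H, hH, e, hid, hmat⟩ := hγ
  rw [trace_eq_finrank_add_trace_toMatrix_mapQ hH e hid, hmat, Matrix.trace_fin_two_of]
  have hrank := H.finrank_quotient_add_finrank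
  rw [Module.finrank_eq_card_basis e, Module.finrank_fin_fun, Fintype.card_fin] at hrank
  have hrank' : (2 : ℝ) + Module.finrank ℝ H = n + 1 := by exact_mod_cast hrank
  linarith

theorem trace_reflection_mul_reflection {K V : Type*} [Field K] [AddCommGroup V] [Module K V]
    [FiniteDimensional K V] {α β : Module.Dual K V} {b c : V} (hα : α b = 2) (hβ : β c = 2) :
    LinearMap.trace K V (Module.reflection hα * Module.reflection hβ : V ≃ₗ[K] V) =
      Module.finrank K V - 4 + α c * β b := by
  have hprod : ((Module.reflection hα * Module.reflection hβ : V ≃ₗ[K] V) : V →ₗ[K] V) =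
      LinearMap.id - β.smulRight c - α.smulRight b + α c • β.smulRight b := by
    ext v
    simp only [LinearEquiv.coe_coe, LinearEquiv.mul_apply, Module.reflection_apply, map_sub,
      map_smul, LinearMap.add_apply, LinearMap.sub_apply, LinearMap.smul_apply,
      LinearMap.smulRight_apply, LinearMap.id_apply]
    module
  rw [hprod]
  simp only [map_add, map_sub, map_smul, LinearMap.trace_smulRight, LinearMap.trace_id, hα, hβ,
    smul_eq_mul]
  ring

namespace MirrorPolytope

variable {n : ℕ} {S : Type} [Finite S] {P : MirrorPolytope n S}

theorem sq_cos_of_isRotation {s t : S} {θ : ℝ} (hθ : IsRotation (P.refl s * P.refl t) (2 * θ)) :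
    P.α s (P.b t) * P.α t (P.b s) = 4 * Real.cos θ ^ 2 := by
  have htrace := hθ.trace_eq.symm.trans
    (trace_reflection_mul_reflection (P.apply_self s) (P.apply_self t))
  rw [Real.cos_two_mul, Module.finrank_fin_fun] at htrace
  push_cast at htrace
  linarith

theorem isCoxeter_of_isVinbergFamily {M : CoxeterMatrix S} (h : IsVinbergFamily M P.α P.b) :
    P.IsCoxeter := by
  rintro s t ⟨hst, -⟩ θ (⟨hθ₀, hθ, hrot⟩ | ⟨rfl, -⟩)
  swap
  · exact Or.inl rfl
  have hcos := sq_cos_of_isRotation hrot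
  have hcos₀ : 0 ≤ Real.cos θ := Real.cos_nonneg_of_mem_Icc ⟨by linarith [Real.pi_pos], hθ⟩
  by_cases hM : M s t = 0
  · have hlt : Real.cos θ < 1 := by
      simpa using Real.cos_lt_cos_of_nonneg_of_le_pi le_rfl (by linarith) hθ₀
    nlinarith [h.infinite_angle hM]
  have hM₂ : 2 ≤ M s t := by
    have := M.off_diagonal s t hst
    omega
  have hMle : Real.pi / M s t ≤ Real.pi / 2 := by gcongr; exact_mod_cast hM₂
  have hMpos : 0 ≤ Real.pi / M s t := by positivity
  have hcosM : 0 ≤ Real.cos (Real.pi / M s t) :=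
    Real.cos_nonneg_of_mem_Icc ⟨by linarith [Real.pi_pos], hMle⟩
  have heq : Real.cos θ = Real.cos (Real.pi / M s t) :=
    (sq_eq_sq₀ hcos₀ hcosM).1 (by linarith [h.angle hM])
  exact Or.inr ⟨M s t, hM₂, Real.injOn_cos ⟨hθ₀.le, by linarith⟩ ⟨hMpos, by linarith⟩ heq⟩

/-- The mirror polytope with the same carrier and the same reflections, but with the pairs
`(α s, b s)` replaced by `((d s)⁻¹ • α s, d s • b s)`. -/
noncomputable def rescale (P : MirrorPolytope n S) (d : S → ℝ) (hd : ∀ s, 0 < d s) :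
    MirrorPolytope n S where
  α s := (d s)⁻¹ • P.α s
  b s := d s • P.b s
  carrier := P.carrier
  isPolytope := by
    have hhalf (s : S) : halfSpace ((d s)⁻¹ • P.α s) = halfSpace (P.α s) := by
      simp only [halfSpace, LinearMap.smul_apply,
        smul_nonpos_iff_nonpos_of_pos_left (inv_pos.2 (hd s))]
    simpa only [IsProjectivePolytope, hhalf] using P.isPolytope
  apply_self s := by simp [P.apply_self, (hd s).ne']
  sign s t hst := by
    simpa only [LinearMap.smul_apply, map_smul, smul_neg_iff_of_pos_left, inv_pos, hd, smul_eq_zero,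
      inv_eq_zero, (hd _).ne', false_or] using P.sign s t hst

variable (P) {d : S → ℝ} (hd : ∀ s, 0 < d s)

theorem refl_rescale (s : S) : (P.rescale d hd).refl s = P.refl s := by
  ext1
  ext1 v
  simp [refl, projReflection, rescale, Module.reflection_apply, smul_smul, mul_right_comm,
    (hd s).ne']

theorem facet_rescale (s : S) : (P.rescale d hd).facet s = P.facet s := by
  simp [facet, rescale, (hd s).ne']

theorem reflectionGroup_rescale : (P.rescale d hd).reflectionGroup = P.reflectionGroup := by
  simp only [reflectionGroup, funext (P.refl_rescale hd)]

theorem orbit_rescale : (P.rescale d hd).orbit = P.orbit := by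
  rw [orbit, orbit, reflectionGroup_rescale]
  rfl

theorem isRidge_rescale (s t : S) : (P.rescale d hd).IsRidge s t ↔ P.IsRidge s t := by
  rw [IsRidge, IsRidge, facet_rescale, facet_rescale]

theorem isCoxeter_rescale : (P.rescale d hd).IsCoxeter ↔ P.IsCoxeter := by
  simp only [IsCoxeter, IsDihedralAngle, isRidge_rescale, refl_rescale]

theorem HasCartanMatrix.exists_rescale {P : MirrorPolytope n S} {A : Matrix S S ℝ}
    (hP : P.HasCartanMatrix A) :
    ∃ (d : S → ℝ) (hd : ∀ s, 0 < d s),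
      ∀ s t, (P.rescale d hd).α s ((P.rescale d hd).b t) = A s t := by
  obtain ⟨d, hd, hA⟩ := hP
  refine ⟨d, hd, fun s t => ?_⟩
  have hs := hd s
  have ht := hd t
  simp only [rescale, LinearMap.smul_apply, map_smul, smul_eq_mul, hA]
  field_simp

end MirrorPolytope

open Matrix

section Blocks

/-- The block `A_t` of `C t`. -/
noncomputable def blockA (t : ℝ) : Matrix (Fin 5) (Fin 5) ℝ := (C t).toBlocks₁₁

/-- The block `B_t` of `C t`. -/
noncomputable def blockB (t : ℝ) : Matrix (Fin 5) (Fin 5) ℝ := (C t).toBlocks₂₂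

variable {t : ℝ} {i j : Fin 5}

theorem blockA_eq (t : ℝ) : blockA t =
    !![2, -gbar 0 t, -gbar 1 t, -gbar 2 t, -gbar 3 t;
       -g 0 t, 2, -gbar 0 t, -gbar 1 t, -gbar 2 t;
       -g 1 t, -g 0 t, 2, -gbar 0 t, -gbar 1 t;
       -g 2 t, -g 1 t, -g 0 t, 2, -gbar 0 t;
       -g 3 t, -g 2 t, -g 1 t, -g 0 t, 2] := toBlocks_fromBlocks₁₁ _ _ _ _

theorem blockB_eq (t : ℝ) : blockB t =
    !![2, -(1 / t), -(1 / t), -(1 / t), -(1 / t);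
       -t, 2, -(1 / t), -(1 / t), -(1 / t);
       -t, -t, 2, -(1 / t), -(1 / t);
       -t, -t, -t, 2, -(1 / t);
       -t, -t, -t, -t, 2] := toBlocks_fromBlocks₂₂ _ _ _ _

theorem C_inl_inl (t : ℝ) (i j : Fin 5) : C t (.inl i) (.inl j) = blockA t i j := rfl

theorem C_inr_inr (t : ℝ) (i j : Fin 5) : C t (.inr i) (.inr j) = blockB t i j := rfl

theorem C_inl_inr (t : ℝ) (i j : Fin 5) : C t (.inl i) (.inr j) = if i = j then -h t else 0 :=
  diagonal_apply (fun _ => -h t) i j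

theorem C_inr_inl (t : ℝ) (i j : Fin 5) : C t (.inr i) (.inl j) = if i = j then -2 else 0 :=
  diagonal_apply (fun _ => -2) i j

theorem f_pos (ht : 0 < t) : 0 < f t := by
  unfold f
  positivity

theorem g_pos (ht : 0 < t) (q : ℕ) : 0 < g q t := by
  unfold g
  positivity

theorem gbar_pos (ht : 0 < t) (q : ℕ) : 0 < gbar q t :=
  div_pos (mul_pos four_pos (f_pos ht)) (g_pos ht q)

theorem gbar_mul_g (ht : 0 < t) (q : ℕ) : gbar q t * g q t = 4 * f t :=
  div_mul_cancel₀ _ (g_pos ht q).ne'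

theorem gbar_eq_g_div_sq (ht : 0 < t) {q : ℕ} (hq : q ≤ 3) : gbar q t = g (3 - q) t / t ^ 2 := by
  rw [gbar, div_eq_div_iff (g_pos ht q).ne' (by positivity)]
  unfold f g
  interval_cases q <;> norm_num <;> field_simp <;> ring

theorem two_lt_h (ht : 0 < t) : 2 < h t := by
  have : 0 < 1 / t + t * (t + 2) ^ 4 / ((t ^ 2 + t + 1) * (t ^ 2 + 7 * t + 1)) := by positivity
  unfold h
  linarith

theorem blockA_diag (t : ℝ) (i : Fin 5) : blockA t i i = 2 := by
  rw [blockA_eq]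
  fin_cases i <;> rfl

theorem blockB_diag (t : ℝ) (i : Fin 5) : blockB t i i = 2 := by
  rw [blockB_eq]
  fin_cases i <;> rfl

theorem blockA_neg (ht : 0 < t) (hij : i ≠ j) : blockA t i j < 0 := by
  rw [blockA_eq]
  fin_cases i <;> fin_cases j <;>
    first | exact absurd rfl hij | simp [g_pos ht, gbar_pos ht]

theorem blockB_neg (ht : 0 < t) (hij : i ≠ j) : blockB t i j < 0 := by
  rw [blockB_eq]
  fin_cases i <;> fin_cases j <;> first | exact absurd rfl hij | simp [ht]

theorem blockA_mul_swap (ht : 0 < t) (hij : i ≠ j) : blockA t i j * blockA t j i = 4 * f t := by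
  have hg (q : ℕ) : g q t * gbar q t = 4 * f t := by rw [mul_comm, gbar_mul_g ht]
  rw [blockA_eq]
  fin_cases i <;> fin_cases j <;>
    first | exact absurd rfl hij | simp [gbar_mul_g ht, hg]

theorem blockB_mul_swap (ht : 0 < t) (hij : i ≠ j) : blockB t i j * blockB t j i = 1 := by
  rw [blockB_eq]
  fin_cases i <;> fin_cases j <;> first | exact absurd rfl hij | simp [ht.ne']

theorem blockA_mul_blockB (ht : 0 < t) : blockA t * blockB t = (2 * h t) • 1 := by
  have ht₀ := ht.ne'
  set D := (t ^ 2 + t + 1) * (t ^ 2 + 7 * t + 1) with hD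
  have hD₀ : D ≠ 0 := by positivity
  have hg₀ : g 0 t = 2 * (2 * t + 1) ^ 3 / D := by simp [g, hD]
  have hg₁ : g 1 t = 2 * t * (t + 2) * (2 * t + 1) ^ 2 / D := by simp [g, hD]
  have hg₂ : g 2 t = 2 * t ^ 2 * (t + 2) ^ 2 * (2 * t + 1) / D := by simp [g, hD]
  have hg₃ : g 3 t = 2 * t ^ 3 * (t + 2) ^ 3 / D := by simp [g, hD]
  have hh : h t = 2 + 1 / t + t * (t + 2) ^ 4 / D := rfl
  rw [blockA_eq, blockB_eq, gbar_eq_g_div_sq ht (by norm_num), gbar_eq_g_div_sq ht (by norm_num),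
    gbar_eq_g_div_sq ht (by norm_num), gbar_eq_g_div_sq ht (by norm_num)]
  norm_num only [hg₀, hg₁, hg₂, hg₃, hh]
  ext i j
  fin_cases i <;> fin_cases j <;>
    simp [mul_apply, Fin.sum_univ_five] <;> field_simp <;> rw [hD] <;> ring

theorem blockB_mul_blockA (ht : 0 < t) : blockB t * blockA t = (2 * h t) • 1 := by
  have hh : 2 * h t ≠ 0 := by linarith [two_lt_h ht]
  have hinv : blockA t * ((2 * h t)⁻¹ • blockB t) = 1 := by
    rw [Matrix.mul_smul, blockA_mul_blockB ht, inv_smul_smul₀ hh]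
  rw [mul_eq_one_comm, Matrix.smul_mul] at hinv
  rw [← hinv, smul_inv_smul₀ hh]

theorem exists_pos_vecMul_blockB_neg (ht : 0 < t) :
    ∃ l : Fin 5 → ℝ, (∀ i, 0 < l i) ∧ ∀ j, (l ᵥ* blockB t) j < 0 := by
  obtain ⟨u, hu, rfl⟩ : ∃ u : ℝ, 0 < u ∧ u ^ 5 = t :=
    ⟨t ^ (5⁻¹ : ℝ), by positivity,
      by exact_mod_cast Real.rpow_inv_natCast_pow ht.le (n := 5) (by norm_num)⟩
  -- Conjugating `B_t` by `diag (u ^ 8, …, u ^ 2, 1)` gives a circulant matrix, whence the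
  -- Perron eigenvector `l`.
  set l : Fin 5 → ℝ := ![u ^ 8, u ^ 6, u ^ 4, u ^ 2, 1] with hl
  have hlpos (i : Fin 5) : 0 < l i := by fin_cases i <;> simp [hl, pow_pos hu]
  refine ⟨l, hlpos, fun j => ?_⟩
  have heigen : l ᵥ* blockB (u ^ 5) = -(((u ^ 3 - 1) ^ 2 + u ^ 4 + u ^ 2) / u ^ 3) • l := by
    rw [blockB_eq]
    ext j
    fin_cases j <;> simp [hl, vecMul, dotProduct, Fin.sum_univ_five] <;> field_simp <;> ring
  rw [heigen, Pi.smul_apply, smul_eq_mul, neg_mul, neg_lt_zero]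
  exact mul_pos (by positivity) (hlpos j)

theorem exists_pos_blockB_mulVec_neg (ht : 0 < t) :
    ∃ y : Fin 5 → ℝ, (∀ i, 0 < y i) ∧ ∀ i, (blockB t *ᵥ y) i < 0 := by
  obtain ⟨l, hl, hlB⟩ := exists_pos_vecMul_blockB_neg ht
  have hrev : blockB t = ((blockB t)ᵀ).submatrix Fin.revPerm Fin.revPerm := by
    rw [blockB_eq]
    ext i j
    fin_cases i <;> fin_cases j <;> rfl
  refine ⟨l ∘ Fin.revPerm, fun i => hl _, fun i => ?_⟩
  rw [hrev, submatrix_mulVec_equiv, Function.comp_assoc, Equiv.self_comp_symm,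
    Function.comp_id, mulVec_transpose]
  exact hlB _

theorem C_diag (t : ℝ) (s : Fin 5 ⊕ Fin 5) : C t s s = 2 := by
  rcases s with i | i
  exacts [blockA_diag t i, blockB_diag t i]

theorem C_sign (ht : 0 < t) {s r : Fin 5 ⊕ Fin 5} (hsr : s ≠ r) :
    (C t s r < 0 ∧ C t r s < 0) ∨ (C t s r = 0 ∧ C t r s = 0) := by
  have hh : -h t < 0 := by linarith [two_lt_h ht]
  rcases s with i | i <;> rcases r with j | j
  · have hij : i ≠ j := ne_of_apply_ne Sum.inl hsr
    exact Or.inl ⟨blockA_neg ht hij, blockA_neg ht hij.symm⟩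
  · obtain rfl | hij := eq_or_ne i j
    · simp [C_inl_inr, C_inr_inl, hh]
    · simp [C_inl_inr, C_inr_inl, hij, hij.symm]
  · obtain rfl | hij := eq_or_ne i j
    · simp [C_inl_inr, C_inr_inl, hh]
    · simp [C_inl_inr, C_inr_inl, hij, hij.symm]
  · have hij : i ≠ j := ne_of_apply_ne Sum.inr hsr
    exact Or.inl ⟨blockB_neg ht hij, blockB_neg ht hij.symm⟩

end Blocks

section ZeroSets

variable {ι : Type*} [Fintype ι] {M : Matrix ι ι ℝ} {y : ι → ℝ}

theorem eq_zero_of_apply_eq_zero_of_mulVec_apply_eq_zero (hneg : ∀ i j, i ≠ j → M i j < 0)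
    (hy : ∀ i, 0 ≤ y i) {i : ι} (hyi : y i = 0) (hMy : (M *ᵥ y) i = 0) : y = 0 := by
  have hterm (j : ι) : M i j * y j ≤ 0 := by
    obtain rfl | hij := eq_or_ne i j
    · rw [hyi, mul_zero]
    · exact mul_nonpos_of_nonpos_of_nonneg (hneg i j hij).le (hy j)
  rw [mulVec, dotProduct, Finset.sum_eq_zero_iff_of_nonpos fun j _ => hterm j] at hMy
  ext j
  obtain rfl | hij := eq_or_ne i j
  · exact hyi
  · exact (mul_eq_zero.1 (hMy j (Finset.mem_univ j))).resolve_left (hneg i j hij).ne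

theorem eq_zero_of_mulVec_nonpos_of_support_subset_pair (hdiag : ∀ i, M i i = 2)
    (hneg : ∀ i j, i ≠ j → M i j < 0) (hmul : ∀ i j, i ≠ j → M i j * M j i < 4)
    (hy : ∀ i, 0 ≤ y i) (hMy : ∀ i, (M *ᵥ y) i ≤ 0) {l m : ι} (hlm : l ≠ m)
    (hsupp : ∀ r, r ≠ l → r ≠ m → y r = 0) : y = 0 := by
  have hsum (i : ι) : M i l * y l + M i m * y m ≤ 0 := by
    rw [← Finset.sum_eq_add (s := Finset.univ) (f := fun r => M i r * y r) l m hlm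
      (fun r _ hr => by rw [hsupp r hr.1 hr.2, mul_zero]) (by simp) (by simp)]
    exact hMy i
  have hl := hsum l
  have hm := hsum m
  rw [hdiag] at hl hm
  have hyl : y l = 0 := by
    nlinarith [hneg l m hlm, hmul l m hlm, hy l,
      mul_nonneg_of_nonpos_of_nonpos (hneg l m hlm).le hm]
  have hym : y m = 0 := by
    rw [hyl, mul_zero, zero_add] at hm
    linarith [hy m]
  ext r
  by_cases hrl : r = l
  · rw [hrl, hyl, Pi.zero_apply]
  by_cases hrm : r = m
  · rw [hrm, hym, Pi.zero_apply]
  exact hsupp r hrl hrm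

theorem exists_zeros_subset_pair {M : Matrix (Fin 5) (Fin 5) ℝ} {y : Fin 5 → ℝ}
    (hdiag : ∀ i, M i i = 2) (hneg : ∀ i j, i ≠ j → M i j < 0)
    (hmul : ∀ i j, i ≠ j → M i j * M j i < 4) (hy : ∀ i, 0 ≤ y i)
    (hMy : ∀ i, (M *ᵥ y) i ≤ 0) (hne : y ≠ 0) : ∃ i j, {r | y r = 0} ⊆ {i, j} := by
  have hpair (Z : Finset (Fin 5)) :
      (∃ i j, Z ⊆ {i, j}) ∨ ∃ l m, l ≠ m ∧ ∀ r, r ≠ l → r ≠ m → r ∈ Z := by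
    revert Z
    decide
  obtain ⟨i, j, hZ⟩ | ⟨l, m, hlm, hZ⟩ := hpair {r | y r = 0}
  · exact ⟨i, j, fun r hr => by simpa using hZ (Finset.mem_filter.2 ⟨Finset.mem_univ r, hr⟩)⟩
  · refine absurd ?_ hne
    exact eq_zero_of_mulVec_nonpos_of_support_subset_pair hdiag hneg hmul hy hMy hlm
      fun r hrl hrm => (Finset.mem_filter.1 (hZ r hrl hrm)).2

end ZeroSets

section CartanMatrix

variable {t : ℝ} {α : Fin 5 ⊕ Fin 5 → Module.Dual ℝ (Vec 4)} {b : Fin 5 ⊕ Fin 5 → Vec 4}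

/-- The Coxeter matrix attached to `C t` when `f t = cos² (π / p)`: the facets `F'_i` make angles
`π / p` with one another, the facets `F_i` make angles `π / 3`, and `F'_i` is orthogonal to every
`F_j` except `F_i`, for which the entry `0` encodes `∞`. -/
def coxeterMatrix (p : ℕ) (hp : p ≠ 1) : CoxeterMatrix (Fin 5 ⊕ Fin 5) where
  M := fromBlocks (.of fun i j => if i = j then 1 else p) (.of fun i j => if i = j then 0 else 2)
    (.of fun i j => if i = j then 0 else 2) (.of fun i j => if i = j then 1 else 3)
  isSymm := by
    refine IsSymm.fromBlocks ?_ ?_ ?_ <;> ext i j <;> simp [eq_comm]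
  diagonal := by rintro (i | i) <;> simp
  off_diagonal := by
    rintro (i | i) (j | j) hij <;> aesop

section

variable {p : ℕ} {hp : p ≠ 1} (i j : Fin 5)

theorem coxeterMatrix_inl_inl :
    coxeterMatrix p hp (.inl i) (.inl j) = if i = j then 1 else p := rfl

theorem coxeterMatrix_inr_inr :
    coxeterMatrix p hp (.inr i) (.inr j) = if i = j then 1 else 3 := rfl

theorem coxeterMatrix_inl_inr :
    coxeterMatrix p hp (.inl i) (.inr j) = if i = j then 0 else 2 := rfl

theorem coxeterMatrix_inr_inl :
    coxeterMatrix p hp (.inr i) (.inl j) = if i = j then 0 else 2 := rfl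

end

theorem isVinbergFamily_coxeterMatrix (hC : ∀ s r, α s (b r) = C t s r) (ht : 0 < t) {p : ℕ}
    (hp₀ : p ≠ 0) (hp₁ : p ≠ 1) (hf : Real.cos (Real.pi / p) ^ 2 = f t) :
    IsVinbergFamily (coxeterMatrix p hp₁) α b where
  apply_self s := by rw [hC, C_diag]
  sign hst := by simpa only [hC] using C_sign ht hst
  angle {s r} hm := by
    rw [hC, hC]
    obtain rfl | hsr := eq_or_ne s r
    · rw [CoxeterMatrix.diagonal, C_diag]
      norm_num
    rcases s with i | i <;> rcases r with j | j
    · have hij : i ≠ j := ne_of_apply_ne Sum.inl hsr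
      rw [coxeterMatrix_inl_inl, if_neg hij, hf]
      exact blockA_mul_swap ht hij
    · have hij : i ≠ j := by
        rintro rfl
        simp [coxeterMatrix_inl_inr] at hm
      simp [coxeterMatrix_inl_inr, C_inl_inr, hij]
    · have hij : i ≠ j := by
        rintro rfl
        simp [coxeterMatrix_inr_inl] at hm
      simp [coxeterMatrix_inr_inl, C_inr_inl, hij]
    · have hij : i ≠ j := ne_of_apply_ne Sum.inr hsr
      rw [coxeterMatrix_inr_inr, if_neg hij, Nat.cast_ofNat, Real.cos_pi_div_three]
      exact (blockB_mul_swap ht hij).trans (by norm_num)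
  infinite_angle {s r} hm := by
    have hh := two_lt_h ht
    rw [hC, hC]
    rcases s with i | i <;> rcases r with j | j
    · rw [coxeterMatrix_inl_inl] at hm
      split_ifs at hm
      exact absurd hm hp₀
    · have hij : i = j := by simpa [coxeterMatrix_inl_inr] using hm
      simp only [C_inl_inr, C_inr_inl, hij, if_true]
      linarith
    · have hij : i = j := by simpa [coxeterMatrix_inr_inl] using hm
      simp only [C_inl_inr, C_inr_inl, hij, if_true]
      linarith
    · rw [coxeterMatrix_inr_inr] at hm
      split_ifs at hm

theorem exists_forall_apply_b_pos (hC : ∀ s r, α s (b r) = C t s r) (ht : 0 < t) :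
    ∃ φ : Module.Dual ℝ (Vec 4), ∀ s, 0 < φ (b s) := by
  obtain ⟨l, hl, hlB⟩ := exists_pos_vecMul_blockB_neg ht
  refine ⟨-∑ i, l i • α (.inr i), fun s => ?_⟩
  simp only [LinearMap.neg_apply, LinearMap.sum_apply, LinearMap.smul_apply, hC, smul_eq_mul,
    neg_pos]
  rcases s with j | j
  · simpa [C_inr_inl] using hl j
  · exact hlB j

theorem exists_forall_apply_neg (hC : ∀ s r, α s (b r) = C t s r) (ht : 0 < t) :
    ∃ v, ∀ s, α s v < 0 := by
  obtain ⟨y, hy, hBy⟩ := exists_pos_blockB_mulVec_neg ht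
  refine ⟨∑ j, y j • b (.inr j), fun s => ?_⟩
  simp only [map_sum, map_smul, hC, smul_eq_mul]
  rcases s with i | i
  · have hh := two_lt_h ht
    simp only [C_inl_inr, mul_ite, mul_zero, Finset.sum_ite_eq, Finset.mem_univ, if_true]
    nlinarith [hy i]
  · simpa only [mulVec, dotProduct, C_inr_inr, mul_comm] using hBy i

theorem sum_smul_b_inl (hC : ∀ s r, α s (b r) = C t s r) (x : Vec 4) :
    ∑ j, (-α (.inr j) x / 2) • b (.inl j) = x := by
  have hli : LinearIndependent ℝ fun j => b (.inl j) :=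
    .of_pairwise_dual_eq_zero_one _ (fun j => (-2⁻¹ : ℝ) • α (.inr j))
      (fun i j hij => by simp [hC, C_inr_inl, hij]) fun i => by simp [hC, C_inr_inl]
  obtain ⟨c, rfl⟩ := (Submodule.mem_span_range_iff_exists_fun ℝ).1
    ((hli.span_eq_top_of_card_eq_finrank' (by simp)).ge (Submodule.mem_top (x := x)))
  simp [hC, C_inr_inl]

theorem mem_hull_of_mem_chamber (hC : ∀ s r, α s (b r) = C t s r) {x : Vec 4}
    (hx : x ∈ chamber α) : x ∈ PointedCone.hull ℝ (Set.range b) := by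
  rw [← sum_smul_b_inl hC x]
  refine sum_mem fun j _ => PointedCone.smul_mem _ ?_ (PointedCone.subset_hull ⟨_, rfl⟩)
  linarith [hx (.inr j)]

theorem blockA_mulVec (hC : ∀ s r, α s (b r) = C t s r) (x : Vec 4) :
    blockA t *ᵥ (fun j => -α (.inr j) x) = (-2 : ℝ) • fun i => -α (.inl i) x := by
  ext i
  conv_rhs => rw [← sum_smul_b_inl hC x]
  simp only [mulVec, dotProduct, Pi.smul_apply, map_sum, map_smul, hC, C_inl_inl, smul_eq_mul,
    Finset.mul_sum, ← Finset.sum_neg_distrib]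
  exact Finset.sum_congr rfl fun j _ => by ring

theorem blockB_mulVec (hC : ∀ s r, α s (b r) = C t s r) (ht : 0 < t) (x : Vec 4) :
    blockB t *ᵥ (fun i => -α (.inl i) x) = -h t • fun j => -α (.inr j) x := by
  have hBA := congrArg (blockB t *ᵥ ·) (blockA_mulVec hC x)
  simp only [mulVec_mulVec, blockB_mul_blockA ht, mulVec_smul, smul_mulVec, one_mulVec] at hBA
  ext i
  have := congrFun hBA i
  simp only [Pi.smul_apply, smul_eq_mul] at this ⊢
  linarith

theorem isProjectivePolytope_of_cartan (hC : ∀ s r, α s (b r) = C t s r) (ht : 0 < t) :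
    IsProjectivePolytope (⋂ s, halfSpace (α s)) α := by
  obtain ⟨φ, hφ⟩ := exists_forall_apply_b_pos hC ht
  obtain ⟨v, hv⟩ := exists_forall_apply_neg hC ht
  refine isProjectivePolytope_iInter_halfSpace (fun s => ?_) (fun s r hsr => ?_) hφ
    (fun x => mem_hull_of_mem_chamber hC) hv
  · rw [hC, C_diag]
    exact two_pos
  · rw [hC]
    rcases C_sign ht hsr with hneg | hzero
    exacts [hneg.1.le, hzero.1.le]

section Faces

variable (hC : ∀ s r, α s (b r) = C t s r) (ht : 0 < t) {x : Vec 4}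

include hC

theorem apply_inr_ne_zero (hx₀ : x ≠ 0) : (fun j => -α (.inr j) x) ≠ 0 := by
  refine fun hzero => hx₀ ?_
  rw [← sum_smul_b_inl hC x]
  exact Finset.sum_eq_zero fun j _ => by simp [neg_eq_zero.1 (congrFun hzero j)]

include ht

theorem apply_inl_ne_zero (hx₀ : x ≠ 0) : (fun i => -α (.inl i) x) ≠ 0 := by
  intro hzero
  have hB := blockB_mulVec hC ht x
  rw [hzero, mulVec_zero, eq_comm, smul_eq_zero] at hB
  exact hB.elim (fun hh => by linarith [two_lt_h ht]) (apply_inr_ne_zero hC hx₀)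

theorem exists_zeros_inl_subset_pair (hx : x ∈ chamber α) (hx₀ : x ≠ 0) :
    ∃ i j, {i | α (.inl i) x = 0} ⊆ {i, j} := by
  have hnonneg (s : Fin 5 ⊕ Fin 5) : 0 ≤ -α s x := neg_nonneg.2 (hx s)
  simpa only [neg_eq_zero] using exists_zeros_subset_pair (blockB_diag t)
    (fun _ _ => blockB_neg ht) (fun i j hij => by rw [blockB_mul_swap ht hij]; norm_num)
    (fun i => hnonneg (.inl i)) (fun i => by
      rw [blockB_mulVec hC ht, Pi.smul_apply, smul_eq_mul]
      exact mul_nonpos_of_nonpos_of_nonneg (by linarith [two_lt_h ht]) (hnonneg (.inr i)))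
    (apply_inl_ne_zero hC ht hx₀)

theorem exists_zeros_inr_subset_pair (hf : f t < 1) (hx : x ∈ chamber α) (hx₀ : x ≠ 0) :
    ∃ i j, {j | α (.inr j) x = 0} ⊆ {i, j} := by
  have hnonneg (s : Fin 5 ⊕ Fin 5) : 0 ≤ -α s x := neg_nonneg.2 (hx s)
  simpa only [neg_eq_zero] using exists_zeros_subset_pair (blockA_diag t)
    (fun _ _ => blockA_neg ht) (fun i j hij => by rw [blockA_mul_swap ht hij]; linarith)
    (fun j => hnonneg (.inr j)) (fun j => by
      rw [blockA_mulVec hC, Pi.smul_apply, smul_eq_mul]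
      exact mul_nonpos_of_nonpos_of_nonneg (by norm_num) (hnonneg (.inl j)))
    (apply_inr_ne_zero hC hx₀)

theorem apply_inr_ne_zero_of_apply_inl_eq_zero (hx : x ∈ chamber α) (hx₀ : x ≠ 0) {i : Fin 5}
    (hi : α (.inl i) x = 0) : α (.inr i) x ≠ 0 := by
  refine fun hi' => apply_inr_ne_zero hC hx₀ ?_
  refine eq_zero_of_apply_eq_zero_of_mulVec_apply_eq_zero (fun _ _ => blockA_neg ht)
    (fun j => neg_nonneg.2 (hx _)) (neg_eq_zero.2 hi') ?_
  rw [blockA_mulVec hC, Pi.smul_apply, hi, neg_zero, smul_zero]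

theorem finite_closure_simple_image_zeros (hf : f t < 1) {p : ℕ} (hp₀ : p ≠ 0) (hp₁ : p ≠ 1)
    {W : Type*} [Group W] (cs : CoxeterSystem (coxeterMatrix p hp₁) W) (hx : x ∈ chamber α)
    (hx₀ : x ≠ 0) : Finite (Subgroup.closure (cs.simple '' {s | α s x = 0})) := by
  obtain ⟨i₁, i₂, hI⟩ := exists_zeros_inl_subset_pair hC ht hx hx₀
  obtain ⟨j₁, j₂, hJ⟩ := exists_zeros_inr_subset_pair hC ht hf hx hx₀
  have hinl := finite_closure_simple_image_of_subset_pair cs (s := .inl i₁) (t := .inl i₂)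
    (by rw [coxeterMatrix_inl_inl]; split_ifs <;> omega)
    ((Set.image_mono hI).trans_eq (Set.image_pair _ _ _))
  have hinr := finite_closure_simple_image_of_subset_pair cs (s := .inr j₁) (t := .inr j₂)
    (by rw [coxeterMatrix_inr_inr]; split_ifs <;> omega)
    ((Set.image_mono hJ).trans_eq (Set.image_pair _ _ _))
  have hzeros : {s | α s x = 0} =
      Sum.inl '' {i | α (.inl i) x = 0} ∪ Sum.inr '' {j | α (.inr j) x = 0} := by
    ext (i | i) <;> simp
  rw [hzeros]
  refine finite_closure_simple_image_union cs ?_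
  rintro _ ⟨i, hi, rfl⟩ _ ⟨j, hj, rfl⟩
  rw [coxeterMatrix_inl_inr, if_neg]
  rintro rfl
  exact apply_inr_ne_zero_of_apply_inl_eq_zero hC ht hx hx₀ hi hj

end Faces

end CartanMatrix

namespace MirrorPolytope

variable {P : MirrorPolytope 4 (Fin 5 ⊕ Fin 5)} {t : ℝ} {p : ℕ}

theorem HasCartanMatrix.isCoxeter (hP : P.HasCartanMatrix (C t)) (ht : 0 < t) (hp₀ : p ≠ 0)
    (hp₁ : p ≠ 1) (hf : Real.cos (Real.pi / p) ^ 2 = f t) : P.IsCoxeter := by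
  obtain ⟨d, hd, hC⟩ := hP.exists_rescale
  exact (P.isCoxeter_rescale hd).1
    (isCoxeter_of_isVinbergFamily (isVinbergFamily_coxeterMatrix hC ht hp₀ hp₁ hf))

theorem HasCartanMatrix.divides_orbit (hP : P.HasCartanMatrix (C t)) (ht : 0 < t) (hp₀ : p ≠ 0)
    (hp₁ : p ≠ 1) (hf : Real.cos (Real.pi / p) ^ 2 = f t) (hf₁ : f t < 1) :
    Divides P.reflectionGroup P.orbit := by
  obtain ⟨d, hd, hC⟩ := hP.exists_rescale
  obtain ⟨φ, hφ⟩ := exists_forall_apply_b_pos hC ht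
  rw [← P.reflectionGroup_rescale hd, ← P.orbit_rescale hd]
  have cs := (coxeterMatrix p hp₁).toCoxeterSystem
  exact MirrorPolytope.divides_orbit (isVinbergFamily_coxeterMatrix hC ht hp₀ hp₁ hf) cs hφ
    (fun _ => mem_hull_of_mem_chamber hC)
    fun _ => finite_closure_simple_image_zeros hC ht hf₁ hp₀ hp₁ cs

end MirrorPolytope

section Realization

variable {t : ℝ}

/-- Linear forms which, together with `realizationPole`, realize the Cartan matrix `C t`, in the
coordinates for which the forms of the facets `F_i` are minus the coordinate functions. -/
noncomputable def realizationForm (t : ℝ) : Fin 5 ⊕ Fin 5 → Module.Dual ℝ (Vec 4) :=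
  Sum.elim (fun i => (2⁻¹ : ℝ) • (LinearMap.proj i ∘ₗ (blockA t).mulVecLin))
    fun i => -LinearMap.proj i

/-- The vectors which, together with `realizationForm`, realize the Cartan matrix `C t`. -/
noncomputable def realizationPole (t : ℝ) : Fin 5 ⊕ Fin 5 → Vec 4 :=
  Sum.elim (fun j => Pi.single j 2) fun j => -(blockB t).col j

theorem realizationForm_realizationPole (ht : 0 < t) (s r : Fin 5 ⊕ Fin 5) :
    realizationForm t s (realizationPole t r) = C t s r := by
  rcases s with i | i <;> rcases r with j | j
  · simp only [realizationForm, realizationPole, Sum.elim_inl, LinearMap.smul_apply,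
      LinearMap.comp_apply, mulVecLin_apply, mulVec_single, LinearMap.proj_apply, Pi.smul_apply,
      C_inl_inl, col_apply, op_smul_eq_smul, smul_eq_mul]
    ring
  · have hAB : (blockA t *ᵥ (blockB t).col j) i = if i = j then 2 * h t else 0 := by
      change (blockA t * blockB t) i j = _
      simp [blockA_mul_blockB ht, one_apply]
    have hform : realizationForm t (.inl i) (realizationPole t (.inr j)) =
        -(2⁻¹ * (blockA t *ᵥ (blockB t).col j) i) := by
      simp [realizationForm, realizationPole, mulVec_neg]
    rw [hform, hAB, C_inl_inr]
    split_ifs <;> simp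
  · simp [realizationForm, realizationPole, C_inr_inl, Pi.single_apply, apply_ite]
  · simp [realizationForm, realizationPole, C_inr_inr]

theorem exists_hasCartanMatrix_C (ht : 0 < t) :
    ∃ P : MirrorPolytope 4 (Fin 5 ⊕ Fin 5), P.HasCartanMatrix (C t) := by
  have hC := realizationForm_realizationPole ht
  let P : MirrorPolytope 4 (Fin 5 ⊕ Fin 5) :=
    { α := realizationForm t
      b := realizationPole t
      carrier := ⋂ s, halfSpace (realizationForm t s)
      isPolytope := isProjectivePolytope_of_cartan hC ht
      apply_self s := by rw [hC, C_diag]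
      sign s r hsr := by simpa only [hC] using C_sign ht hsr }
  exact ⟨P, 1, fun _ => one_pos, by simp [P, hC]⟩

end Realization

section Parameter

theorem t₃_pos : 0 < t₃ := by
  have hsq : √2 ^ 2 = 2 := Real.sq_sqrt two_pos.le
  have hlt : √(31 + 22 * √2) < (11 + 9 * √2) / 3 := by
    rw [Real.sqrt_lt' (by positivity)]
    nlinarith [Real.sqrt_nonneg 2]
  unfold t₃
  linarith

theorem t₃_le_one : t₃ ≤ 1 := by
  have hsq : √2 ^ 2 = 2 := Real.sq_sqrt two_pos.le
  have hle : 3 + 3 * √2 ≤ √(31 + 22 * √2) := by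
    apply Real.le_sqrt_of_sq_le
    nlinarith [Real.sqrt_nonneg 2]
  unfold t₃
  linarith

theorem t₃_sq_add_one : t₃ ^ 2 + 1 = (11 + 9 * √2) * t₃ := by
  have hsq : √2 ^ 2 = 2 := Real.sq_sqrt two_pos.le
  have hsq' : √(31 + 22 * √2) ^ 2 = 31 + 22 * √2 := Real.sq_sqrt (by positivity)
  unfold t₃
  linear_combination 9 / 4 * hsq' - 81 / 4 * hsq

/-- `f` is invariant under `t ↦ t⁻¹`, hence a function of `t + t⁻¹`. -/
theorem f_eq_of_sq_add_one {t x : ℝ} (ht : t ≠ 0) (hx : t ^ 2 + 1 = x * t) :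
    f t = (2 * x + 5) ^ 3 / ((x + 1) ^ 2 * (x + 7) ^ 2) := by
  have hfac₁ : t ^ 2 + t + 1 = (x + 1) * t := by linear_combination hx
  have hfac₇ : t ^ 2 + 7 * t + 1 = (x + 7) * t := by linear_combination hx
  have hnum : (t + 2) ^ 3 * (2 * t + 1) ^ 3 = ((2 * x + 5) * t) ^ 3 := by
    rw [← mul_pow]
    congr 1
    linear_combination 2 * hx
  rw [f, hfac₁, hfac₇, mul_assoc t, hnum]
  have hcancel : t * ((2 * x + 5) * t) ^ 3 = (2 * x + 5) ^ 3 * t ^ 4 := by ring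
  have hcancel' : ((x + 1) * t) ^ 2 * ((x + 7) * t) ^ 2 =
      ((x + 1) ^ 2 * (x + 7) ^ 2) * t ^ 4 := by ring
  rw [hcancel, hcancel', mul_div_mul_right _ _ (pow_ne_zero 4 ht)]

theorem f_t₃ : f t₃ = 1 / 4 := by
  rw [f_eq_of_sq_add_one t₃_pos.ne' t₃_sq_add_one, div_eq_div_iff (by positivity) (by norm_num)]
  set x := 11 + 9 * √2 with hx
  have hquad : x ^ 2 = 22 * x + 41 := by
    rw [hx]
    linear_combination 81 * Real.sq_sqrt (two_pos (α := ℝ)).le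
  linear_combination -(x ^ 2 + 6 * x + 11) * hquad

theorem f_one : f 1 = 1 := by norm_num [f]

theorem exists_f_eq {c : ℝ} (hc : c ∈ Set.Icc (1 / 4) 1) : ∃ t ∈ Set.Icc t₃ 1, f t = c := by
  have hcont : ContinuousOn f (Set.Icc t₃ 1) := by
    unfold f
    refine ContinuousOn.div (by fun_prop) (by fun_prop) fun t ht => ?_
    have := t₃_pos.trans_le ht.1
    positivity
  exact intermediate_value_Icc t₃_le_one hcont (by rwa [f_t₃, f_one])

theorem sq_cos_pi_div_mem_Ico {p : ℕ} (hp : 3 ≤ p) :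
    Real.cos (Real.pi / p) ^ 2 ∈ Set.Ico (1 / 4) 1 := by
  have hp' : (3 : ℝ) ≤ p := by exact_mod_cast hp
  have hpos : 0 < Real.pi / p := by positivity
  have hle : Real.pi / p ≤ Real.pi / 3 := by gcongr
  have hlower : 1 / 2 ≤ Real.cos (Real.pi / p) := by
    rw [← Real.cos_pi_div_three]
    exact Real.cos_le_cos_of_nonneg_of_le_pi hpos.le (by linarith [Real.pi_pos]) hle
  have hupper : Real.cos (Real.pi / p) < 1 := by
    rw [← Real.cos_zero]
    exact Real.cos_lt_cos_of_nonneg_of_le_pi le_rfl (by linarith [Real.pi_pos]) hpos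
  exact ⟨by nlinarith, by nlinarith⟩

end Parameter

end ProjGeom

theorem mainTheorem3 (p : ℕ) (hp : 3 ≤ p) :
    (∃ P : ProjGeom.MirrorPolytope 4 (Fin 5 ⊕ Fin 5),
      ProjGeom.IsPolytopeOfAngle (Real.pi / p) P) ∧
    ∀ P : ProjGeom.MirrorPolytope 4 (Fin 5 ⊕ Fin 5),
      ProjGeom.IsPolytopeOfAngle (Real.pi / p) P →
        P.IsCoxeter ∧
        ProjGeom.IsProperlyConvexDomain P.orbit ∧
        interior P.orbit = P.orbit ∧
        ProjGeom.Divides P.reflectionGroup P.orbit := by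
  have hcos := ProjGeom.sq_cos_pi_div_mem_Ico hp
  constructor
  · obtain ⟨t, ht, hf⟩ := ProjGeom.exists_f_eq (Set.Ico_subset_Icc_self hcos)
    obtain ⟨P, hP⟩ := ProjGeom.exists_hasCartanMatrix_C (ProjGeom.t₃_pos.trans_le ht.1)
    exact ⟨P, ⟨by positivity, by gcongr; exact_mod_cast hp⟩, t, ht, hf.symm, hP⟩
  · rintro P ⟨-, t, ht, hf, hP⟩
    have ht₀ := ProjGeom.t₃_pos.trans_le ht.1
    have hdiv := hP.divides_orbit ht₀ (by omega) (by omega) hf (hf ▸ hcos.2)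
    exact ⟨hP.isCoxeter ht₀ (by omega) (by omega) hf, hdiv.1, hdiv.1.2.1.interior_eq, hdiv⟩
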